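/- Let $0\le n\le\infty$. Let $\mathrm{Cat}_n$ be the category of small strict $n$-categories and strict $n$-functors, and let $\mathrm{Cat}_n^{\mathrm{rig}}$ be its full subcategory on the rigid strict $n$-categories, that is, those in which, for every $k$ with $1\le k\le n$, every strictly invertible $k$-arrow is the identity of a $(k-1)$-arrow. For a category $\mathcal C$, let $\mathrm{Aut}(\mathcal C)$ be the full subcategory of the category of functors $\mathcal C\to\mathcal C$ (and all natural transformations) on the equivalences of categories; it is a strict monoidal category under composition of functors. Let $(\mathbb Z/2\mathbb Z)^n=\prod_{1\le i\le n}\mathbb Z/2\mathbb Z$ (the full product over all $i\ge 1$ if $n=\infty$), regarded as a discrete monoidal category by means of its group law. For $\delta\in(\mathbb Z/2\mathbb Z)^n$ let $\mathrm{op}_\delta$ be the autoequivalence of $\mathrm{Cat}_n$ that sends $C$ to the strict $n$-category obtained from $C$ by reversing the orientation of the $i$-arrows for all $i$ with $\delta_i=1$; it restricts to an autoequivalence of $\mathrm{Cat}_n^{\mathrm{rig}}$. Then the functors $$(\mathbb Z/2\mathbb Z)^n\longrightarrow \mathrm{Aut}(\mathrm{Cat}_n),\qquad (\mathbb Z/2\mathbb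 Z)^n\longrightarrow \mathrm{Aut}(\mathrm{Cat}_n^{\mathrm{rig}}),\qquad \delta\mapsto \mathrm{op}_\delta,$$ are equivalences of monoidal categories, i.e. each is an equivalence of categories and carries the structure of a (strong) monoidal functor. -/

import Mathlib

open CategoryTheory

universe u v w

namespace StrictHigherCat

/-- The dimensions `k` with `0 ≤ k ≤ n`. -/
abbrev Dim (n : ℕ∞) : Type := {k : ℕ // (k : ℕ∞) ≤ n}

end StrictHigherCat

open StrictHigherCat

/-- A small strict `n`-category, `0 ≤ n ≤ ∞`: for every dimension `k ≤ n` a set of `k`-arrows, for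
`j < k ≤ n` the `j`-dimensional (iterated) source and target of a `k`-arrow, the (iterated) identity
of a `j`-arrow in dimension `k`, and the composite `x *_j y` of two `k`-arrows such that the
`j`-source of `x` is the `j`-target of `y`. -/
structure StrictNCat (n : ℕ∞) : Type (u + 1) where
  /-- the `k`-arrows -/
  Arr : Dim n → Type u
  src {j k : Dim n} : j < k → Arr k → Arr j
  tgt {j k : Dim n} : j < k → Arr k → Arr j
  idt {j k : Dim n} : j < k → Arr j → Arr k
  comp {j k : Dim n} (h : j < k) (x y : Arr k) : src h x = tgt h y → Arr k
  -- the globular relations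
  src_src {i j k : Dim n} (h : i < j) (h' : j < k) (x : Arr k) :
    src h (src h' x) = src (h.trans h') x
  src_tgt {i j k : Dim n} (h : i < j) (h' : j < k) (x : Arr k) :
    src h (tgt h' x) = src (h.trans h') x
  tgt_src {i j k : Dim n} (h : i < j) (h' : j < k) (x : Arr k) :
    tgt h (src h' x) = tgt (h.trans h') x
  tgt_tgt {i j k : Dim n} (h : i < j) (h' : j < k) (x : Arr k) :
    tgt h (tgt h' x) = tgt (h.trans h') x
  -- sources and targets of identities, and iterated identities
  src_idt {j k : Dim n} (h : j < k) (x : Arr j) : src h (idt h x) = x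
  tgt_idt {j k : Dim n} (h : j < k) (x : Arr j) : tgt h (idt h x) = x
  idt_idt {i j k : Dim n} (h : i < j) (h' : j < k) (x : Arr i) :
    idt h' (idt h x) = idt (h.trans h') x
  -- sources and targets of composites
  src_comp {j k : Dim n} (h : j < k) (x y : Arr k) (hxy : src h x = tgt h y) :
    src h (comp h x y hxy) = src h y
  tgt_comp {j k : Dim n} (h : j < k) (x y : Arr k) (hxy : src h x = tgt h y) :
    tgt h (comp h x y hxy) = tgt h x
  src_comp_of_lt {i j k : Dim n} (h : i < j) (h' : j < k) (x y : Arr k)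
    (hxy : src (h.trans h') x = tgt (h.trans h') y) (hs : src h (src h' x) = tgt h (src h' y)) :
    src h' (comp (h.trans h') x y hxy) = comp h (src h' x) (src h' y) hs
  tgt_comp_of_lt {i j k : Dim n} (h : i < j) (h' : j < k) (x y : Arr k)
    (hxy : src (h.trans h') x = tgt (h.trans h') y) (ht : src h (tgt h' x) = tgt h (tgt h' y)) :
    tgt h' (comp (h.trans h') x y hxy) = comp h (tgt h' x) (tgt h' y) ht
  -- associativity and units
  assoc {j k : Dim n} (h : j < k) (x y z : Arr k) (hxy : src h x = tgt h y)
    (hyz : src h y = tgt h z) (h₁ : src h (comp h x y hxy) = tgt h z)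
    (h₂ : src h x = tgt h (comp h y z hyz)) :
    comp h (comp h x y hxy) z h₁ = comp h x (comp h y z hyz) h₂
  comp_idt {j k : Dim n} (h : j < k) (x : Arr k) (hx : src h x = tgt h (idt h (src h x))) :
    comp h x (idt h (src h x)) hx = x
  idt_comp {j k : Dim n} (h : j < k) (x : Arr k) (hx : src h (idt h (tgt h x)) = tgt h x) :
    comp h (idt h (tgt h x)) x hx = x
  -- identities are functorial
  idt_comp_idt {i j k : Dim n} (h : i < j) (h' : j < k) (x y : Arr j) (hxy : src h x = tgt h y)
    (hi : src (h.trans h') (idt h' x) = tgt (h.trans h') (idt h' y)) :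
    idt h' (comp h x y hxy) = comp (h.trans h') (idt h' x) (idt h' y) hi
  -- the interchange law `(x *_j y) *_i (z *_j w) = (x *_i z) *_j (y *_i w)`
  interchange {i j k : Dim n} (h : i < j) (h' : j < k) (x y z w : Arr k)
    (hxy : src h' x = tgt h' y) (hzw : src h' z = tgt h' w)
    (hxz : src (h.trans h') x = tgt (h.trans h') z)
    (hyw : src (h.trans h') y = tgt (h.trans h') w)
    (h₁ : src (h.trans h') (comp h' x y hxy) = tgt (h.trans h') (comp h' z w hzw))
    (h₂ : src h' (comp (h.trans h') x z hxz) = tgt h' (comp (h.trans h') y w hyw)) :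
    comp (h.trans h') (comp h' x y hxy) (comp h' z w hzw) h₁ =
      comp h' (comp (h.trans h') x z hxz) (comp (h.trans h') y w hyw) h₂

namespace StrictNCat

variable {n : ℕ∞}

/-- A (strict) functor of strict `n`-categories. -/
@[ext]
structure Hom (C : StrictNCat.{u} n) (D : StrictNCat.{v} n) where
  app (k : Dim n) : C.Arr k → D.Arr k
  map_src {j k : Dim n} (h : j < k) (x : C.Arr k) : app j (C.src h x) = D.src h (app k x)
  map_tgt {j k : Dim n} (h : j < k) (x : C.Arr k) : app j (C.tgt h x) = D.tgt h (app k x)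
  map_idt {j k : Dim n} (h : j < k) (x : C.Arr j) : app k (C.idt h x) = D.idt h (app j x)
  map_comp {j k : Dim n} (h : j < k) (x y : C.Arr k) (hxy : C.src h x = C.tgt h y)
    (hxy' : D.src h (app k x) = D.tgt h (app k y)) :
    app k (C.comp h x y hxy) = D.comp h (app k x) (app k y) hxy'

/-- The category of small strict `n`-categories. -/
instance category : Category (StrictNCat.{u} n) where
  Hom C D := Hom C D
  id C :=
    { app := fun _ x => x
      map_src := fun _ _ => rfl
      map_tgt := fun _ _ => rfl
      map_idt := fun _ _ => rfl
      map_comp := fun _ _ _ _ _ => rfl }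
  comp {C D E} f g :=
    { app := fun k x => g.app k (f.app k x)
      map_src := fun h x => by rw [f.map_src, g.map_src]
      map_tgt := fun h x => by rw [f.map_tgt, g.map_tgt]
      map_idt := fun h x => by rw [f.map_idt, g.map_idt]
      map_comp := fun h x y hxy hxy' => by
        rw [f.map_comp h x y hxy (by rw [← f.map_src, ← f.map_tgt, hxy]), g.map_comp] }

/-- The group `(ℤ/2ℤ)ⁿ = ∏_{1 ≤ i ≤ n} ℤ/2ℤ` (the full product if `n = ∞`). -/
abbrev Signs (n : ℕ∞) : Type := {i : ℕ // 1 ≤ i ∧ (i : ℕ∞) ≤ n} → ZMod 2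

/-- `Reverses δ j` says that `δ_{j+1} = 1`, so that `op_δ` reverses the `(j+1)`-arrows, that is,
exchanges sources and targets in dimension `j`. -/
def Reverses (δ : Signs n) (j : Dim n) : Prop :=
  ∃ h : 1 ≤ j.1 + 1 ∧ ((j.1 + 1 : ℕ) : ℕ∞) ≤ n, δ ⟨j.1 + 1, h⟩ = 1

open Classical in
/-- The strict `n`-category `op_δ(C)`, obtained from `C` by reversing the orientation of the
`i`-arrows for all `i` such that `δ_i = 1`. -/
noncomputable def op (δ : Signs n) (C : StrictNCat.{u} n) : StrictNCat.{u} n where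
  Arr := C.Arr
  src {j _} h x := if Reverses δ j then C.tgt h x else C.src h x
  tgt {j _} h x := if Reverses δ j then C.src h x else C.tgt h x
  idt h x := C.idt h x
  comp {j _} h x y hxy :=
    if hj : Reverses δ j then C.comp h y x (by simpa [hj] using hxy.symm)
    else C.comp h x y (by simpa [hj] using hxy)
  src_src {i j k} h h' x := by
    by_cases hi : Reverses δ i <;> by_cases hj : Reverses δ j <;>
      simp [hi, hj, C.src_src, C.src_tgt, C.tgt_src, C.tgt_tgt]
  src_tgt {i j k} h h' x := by
    by_cases hi : Reverses δ i <;> by_cases hj : Reverses δ j <;>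
      simp [hi, hj, C.src_src, C.src_tgt, C.tgt_src, C.tgt_tgt]
  tgt_src {i j k} h h' x := by
    by_cases hi : Reverses δ i <;> by_cases hj : Reverses δ j <;>
      simp [hi, hj, C.src_src, C.src_tgt, C.tgt_src, C.tgt_tgt]
  tgt_tgt {i j k} h h' x := by
    by_cases hi : Reverses δ i <;> by_cases hj : Reverses δ j <;>
      simp [hi, hj, C.src_src, C.src_tgt, C.tgt_src, C.tgt_tgt]
  src_idt {j k} h x := by by_cases hj : Reverses δ j <;> simp [hj, C.src_idt, C.tgt_idt]
  tgt_idt {j k} h x := by by_cases hj : Reverses δ j <;> simp [hj, C.src_idt, C.tgt_idt]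
  idt_idt h h' x := C.idt_idt h h' x
  src_comp {j k} h x y hxy := by
    by_cases hj : Reverses δ j <;> simp [hj, C.src_comp, C.tgt_comp]
  tgt_comp {j k} h x y hxy := by
    by_cases hj : Reverses δ j <;> simp [hj, C.src_comp, C.tgt_comp]
  src_comp_of_lt {i j k} h h' x y hxy hs := by
    by_cases hi : Reverses δ i <;> by_cases hj : Reverses δ j <;> simp only [hi, hj, dite_true,
      dite_false, if_true, if_false] <;>
      first
      | exact C.src_comp_of_lt h h' _ _ _ _
      | exact C.tgt_comp_of_lt h h' _ _ _ _
  tgt_comp_of_lt {i j k} h h' x y hxy hs := by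
    by_cases hi : Reverses δ i <;> by_cases hj : Reverses δ j <;> simp only [hi, hj, dite_true,
      dite_false, if_true, if_false] <;>
      first
      | exact C.src_comp_of_lt h h' _ _ _ _
      | exact C.tgt_comp_of_lt h h' _ _ _ _
  assoc {j k} h x y z hxy hyz h₁ h₂ := by
    by_cases hj : Reverses δ j <;> simp only [hj, dite_true, dite_false]
    · exact (C.assoc h z y x _ _ _ _).symm
    · exact C.assoc h x y z _ _ _ _
  comp_idt {j k} h x hx := by
    by_cases hj : Reverses δ j <;> simp [hj, C.comp_idt, C.idt_comp]
  idt_comp {j k} h x hx := by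
    by_cases hj : Reverses δ j <;> simp [hj, C.comp_idt, C.idt_comp]
  idt_comp_idt {i j k} h h' x y hxy hi := by
    by_cases hi : Reverses δ i <;> simp only [hi, dite_true, dite_false] <;>
      exact C.idt_comp_idt h h' _ _ _ _
  interchange {i j k} h h' x y z w hxy hzw hxz hyw h₁ h₂ := by
    by_cases hi : Reverses δ i <;> by_cases hj : Reverses δ j <;>
      simp only [hi, hj, dite_true, dite_false] <;>
      exact C.interchange h h' _ _ _ _ _ _ _ _ _ _

/-- The endofunctor `op_δ` of the category of strict `n`-categories; it does not change the maps on
arrows underlying a functor. -/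
noncomputable def opFunctor (δ : Signs n) : StrictNCat.{u} n ⥤ StrictNCat.{u} n where
  obj C := C.op δ
  map {C D} f :=
    { app := f.app
      map_src := fun {j k} h x => by
        by_cases hj : Reverses δ j <;> simp only [op, hj, if_true, if_false]
        · exact f.map_tgt h x
        · exact f.map_src h x
      map_tgt := fun {j k} h x => by
        by_cases hj : Reverses δ j <;> simp only [op, hj, if_true, if_false]
        · exact f.map_src h x
        · exact f.map_tgt h x
      map_idt := f.map_idt
      map_comp := fun {j k} h x y hxy hxy' => by
        by_cases hj : Reverses δ j <;> simp only [op, hj, dite_true, dite_false] <;>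
          exact f.map_comp h _ _ _ _ }

/-- A strict `n`-category is rigid if, for `1 ≤ k ≤ n`, every strictly invertible `k`-arrow is the
identity of a `(k-1)`-arrow. -/
def IsRigid (n : ℕ∞) : ObjectProperty (StrictNCat.{u} n) := fun C =>
  ∀ ⦃j k : Dim n⦄ (h : j < k), k.1 = j.1 + 1 → ∀ (x y : C.Arr k)
    (hxy : C.src h x = C.tgt h y) (hyx : C.src h y = C.tgt h x),
    C.comp h x y hxy = C.idt h (C.tgt h x) → C.comp h y x hyx = C.idt h (C.src h x) →
      ∃ a : C.Arr j, x = C.idt h a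

/-- The category of rigid strict `n`-categories, a full subcategory. -/
abbrev Rigid (n : ℕ∞) : Type (u + 1) := (IsRigid.{u} n).FullSubcategory

lemma IsRigid.op {C : StrictNCat.{u} n} (hC : IsRigid n C) (δ : Signs n) :
    IsRigid n (C.op δ) := by
  intro j k h hjk x y hxy hyx h₁ h₂
  by_cases hj : Reverses δ j <;>
    simp only [StrictNCat.op, hj, if_true, if_false, dite_true, dite_false] at h₁ h₂ hxy hyx ⊢
  · exact hC h hjk x y hyx.symm hxy.symm h₂ h₁
  · exact hC h hjk x y hxy hyx h₁ h₂

/-- The endofunctor of the category of rigid strict `n`-categories induced by `op_δ`. -/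
noncomputable def rigidOpFunctor (δ : Signs n) : Rigid.{u} n ⥤ Rigid.{u} n :=
  (IsRigid n).lift ((IsRigid n).ι ⋙ opFunctor δ) fun C => C.property.op δ

/-- `op_δ` is its own inverse. -/
noncomputable def opOpIso (δ : Signs n) (C : StrictNCat.{u} n) : (C.op δ).op δ ≅ C where
  hom :=
    { app := fun _ x => x
      map_src := fun {j k} h x => by by_cases hj : Reverses δ j <;> simp [op, hj]
      map_tgt := fun {j k} h x => by by_cases hj : Reverses δ j <;> simp [op, hj]
      map_idt := fun h x => rfl
      map_comp := fun {j k} h x y hxy hxy' => by by_cases hj : Reverses δ j <;> simp [op, hj] }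
  inv :=
    { app := fun _ x => x
      map_src := fun {j k} h x => by by_cases hj : Reverses δ j <;> simp [op, hj]
      map_tgt := fun {j k} h x => by by_cases hj : Reverses δ j <;> simp [op, hj]
      map_idt := fun h x => rfl
      map_comp := fun {j k} h x y hxy hxy' => by by_cases hj : Reverses δ j <;> simp [op, hj] }
  hom_inv_id := rfl
  inv_hom_id := rfl

lemma isEquivalence_opFunctor (δ : Signs n) : (opFunctor.{u} δ).IsEquivalence :=
  let e : opFunctor.{u} δ ⋙ opFunctor δ ≅ 𝟭 _ :=
    NatIso.ofComponents (fun C => opOpIso δ C) (fun _ => rfl)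
  (CategoryTheory.Equivalence.mk (opFunctor δ) (opFunctor δ) e.symm e).isEquivalence_functor

lemma isEquivalence_rigidOpFunctor (δ : Signs n) : (rigidOpFunctor.{u} δ).IsEquivalence :=
  let e : rigidOpFunctor.{u} δ ⋙ rigidOpFunctor δ ≅ 𝟭 _ :=
    NatIso.ofComponents (fun C => (IsRigid n).isoMk (opOpIso δ C.obj)) (fun _ => rfl)
  (CategoryTheory.Equivalence.mk (rigidOpFunctor δ) (rigidOpFunctor δ) e.symm e).isEquivalence_functor

end StrictNCat

section Autoequivalences

variable (C : Type v) [Category.{w} C]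

attribute [local instance] endofunctorMonoidalCategory

/-- The property of an endofunctor to be an equivalence of categories. -/
def isAutoequivalence : ObjectProperty (C ⥤ C) := fun F => F.IsEquivalence

instance isAutoequivalence_isMonoidal : (isAutoequivalence C).IsMonoidal where
  prop_unit := inferInstanceAs (𝟭 C).IsEquivalence
  prop_tensor F G hF hG :=
    haveI : F.IsEquivalence := hF
    haveI : G.IsEquivalence := hG
    inferInstanceAs (F ⋙ G).IsEquivalence

/-- The category of autoequivalences of `C` (written `AutCat C`): the full subcategory of the
category of endofunctors of `C` and all natural transformations on the equivalences. -/
abbrev AutCat : Type (max v w) := (isAutoequivalence C).FullSubcategory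

/-- The monoidal structure on the category of autoequivalences given by composition of functors. -/
instance autCatMonoidal : MonoidalCategory (AutCat C) :=
  ObjectProperty.fullMonoidalSubcategory (isAutoequivalence C)

end Autoequivalences

namespace StrictNCat

/-- The functor `δ ↦ op_δ` from the discrete category on `(ℤ/2ℤ)ⁿ` to the category of
autoequivalences of the category of strict `n`-categories. -/
noncomputable def opAut (n : ℕ∞) : Discrete (Signs n) ⥤ AutCat (StrictNCat.{u} n) :=
  Discrete.functor fun δ => ⟨opFunctor δ, isEquivalence_opFunctor δ⟩

/-- The functor `δ ↦ op_δ` from the discrete category on `(ℤ/2ℤ)ⁿ` to the category of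
autoequivalences of the category of rigid strict `n`-categories. -/
noncomputable def rigidOpAut (n : ℕ∞) : Discrete (Signs n) ⥤ AutCat (Rigid.{u} n) :=
  Discrete.functor fun δ => ⟨rigidOpFunctor δ, isEquivalence_rigidOpFunctor δ⟩

end StrictNCat

/-! Both cases follow from one argument about the full subcategory on a class `P` of strict
`n`-categories that contains the globes `D_k` and is closed under sub-`n`-categories, binary
products and `op_δ` (`Admissible`). Since `D_k` represents the set of `k`-arrows, an autoequivalence
`E` is controlled by its effect on globes.

`E` fixes every globe up to isomorphism (`globe_iso`), by induction on the dimension. If the globes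
up to dimension `l` are fixed, then `E` preserves and reflects parallelism of `l`-arrows. In
`D_{l+1}` the only two distinct parallel `l`-arrows are the two faces, and the only endomorphism
that keeps the faces distinct is the identity. A truncation argument yields maps `D_{l+1} →
E(D_{l+1}) → D_{l+1}` neither of which identifies the relevant pair of parallel `l`-arrows
(`exists_nonloop`), and these two maps are then mutually inverse.

Hence the arrows of `C` and of `E(C)` are in natural bijection. In each dimension, sources and
targets are either kept or exchanged, uniformly in `C`; this choice is a sign vector `δ`
(`exists_signs`). After composition with `op_δ` the bijection respects sources and targets, and then
it respects identities and composites automatically (`GlobularIso.nonempty_iso`): the composite of a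
suitably labelled composable pair is recognised by two maps to a globe, where it becomes a composite
with an identity. So `E` is isomorphic to `op_δ`.

A natural transformation `op_δ ⟶ op_δ'` is determined by its values on the top arrows of globes. By
induction it fixes them, and this forces `δ = δ'` (`app_top_succ`). The category of autoequivalences
is therefore equivalent to a discrete one, so the coherence conditions of a monoidal structure hold
automatically. -/

namespace StrictNCat

variable {n : ℕ∞}

/-! ### Iterated boundaries and identities -/

section Basic

variable (C : StrictNCat.{u} n)

/-- The `j`-dimensional target (`b = true`) or source (`b = false`) of a `k`-arrow, `j < k`. -/
def bd (b : Bool) {j k : Dim n} (h : j < k) (x : C.Arr k) : C.Arr j :=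
  bif b then C.tgt h x else C.src h x

@[simp] lemma bd_true {j k : Dim n} (h : j < k) (x : C.Arr k) : C.bd true h x = C.tgt h x := rfl

@[simp] lemma bd_false {j k : Dim n} (h : j < k) (x : C.Arr k) : C.bd false h x = C.src h x := rfl

lemma bd_bd (b b' : Bool) {i j k : Dim n} (h : i < j) (h' : j < k) (x : C.Arr k) :
    C.bd b h (C.bd b' h' x) = C.bd b (h.trans h') x := by
  cases b <;> cases b' <;> simp [C.src_src, C.src_tgt, C.tgt_src, C.tgt_tgt]

lemma bd_idt (b : Bool) {j k : Dim n} (h : j < k) (x : C.Arr j) : C.bd b h (C.idt h x) = x := by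
  cases b <;> simp [C.src_idt, C.tgt_idt]

lemma bd_idt_of_lt (b : Bool) {i j k : Dim n} (h : i < j) (h' : j < k) (x : C.Arr j) :
    C.bd b (h.trans h') (C.idt h' x) = C.bd b h x := by
  rw [← C.bd_bd b b h h', C.bd_idt]

lemma bd_idt_of_gt (b : Bool) {i j k : Dim n} (h : i < j) (h' : j < k) (x : C.Arr i) :
    C.bd b h' (C.idt (h.trans h') x) = C.idt h x := by
  rw [← C.idt_idt h h', C.bd_idt]

lemma comp_of_left_eq_idt {j k : Dim n} (h : j < k) {x y : C.Arr k} (hxy : C.src h x = C.tgt h y)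
    {w : C.Arr j} (hw : x = C.idt h w) : C.comp h x y hxy = y := by
  subst hw
  obtain rfl : w = C.tgt h y := by rw [← hxy, C.src_idt]
  exact C.idt_comp h y _

lemma comp_of_right_eq_idt {j k : Dim n} (h : j < k) {x y : C.Arr k}
    (hxy : C.src h x = C.tgt h y) {w : C.Arr j} (hw : y = C.idt h w) : C.comp h x y hxy = x := by
  subst hw
  obtain rfl : C.src h x = w := by rw [hxy, C.tgt_idt]
  exact C.comp_idt h x _

lemma bd_comp_of_lt (b : Bool) {i j k : Dim n} (h : i < j) (h' : j < k) (x y : C.Arr k)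
    (hxy : C.src (h.trans h') x = C.tgt (h.trans h') y)
    (hb : C.src h (C.bd b h' x) = C.tgt h (C.bd b h' y)) :
    C.bd b h' (C.comp (h.trans h') x y hxy) = C.comp h (C.bd b h' x) (C.bd b h' y) hb := by
  cases b
  · exact C.src_comp_of_lt h h' x y hxy hb
  · exact C.tgt_comp_of_lt h h' x y hxy hb

lemma src_bd (b : Bool) {i j k : Dim n} (h : i < j) (h' : j < k) (x : C.Arr k) :
    C.src h (C.bd b h' x) = C.src (h.trans h') x := C.bd_bd false b h h' x

lemma tgt_bd (b : Bool) {i j k : Dim n} (h : i < j) (h' : j < k) (x : C.Arr k) :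
    C.tgt h (C.bd b h' x) = C.tgt (h.trans h') x := C.bd_bd true b h h' x

lemma bd_comp_of_gt_left (b : Bool) {i j k : Dim n} (h : i < j) (h' : j < k) (x y : C.Arr k)
    (hxy : C.src h' x = C.tgt h' y) :
    C.bd b (h.trans h') (C.comp h' x y hxy) = C.bd b (h.trans h') x := by
  rw [← C.bd_bd b true h h', bd_true, C.tgt_comp, ← bd_true, C.bd_bd]

lemma bd_comp_of_gt_right (b : Bool) {i j k : Dim n} (h : i < j) (h' : j < k) (x y : C.Arr k)
    (hxy : C.src h' x = C.tgt h' y) :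
    C.bd b (h.trans h') (C.comp h' x y hxy) = C.bd b (h.trans h') y := by
  rw [← C.bd_bd b false h h', bd_false, C.src_comp, ← bd_false, C.bd_bd]

lemma comp_congr {j k : Dim n} (h : j < k) {x x' y y' : C.Arr k} (hx : x = x') (hy : y = y')
    (hxy : C.src h x = C.tgt h y) :
    C.comp h x y hxy = C.comp h x' y' (by rw [← hx, ← hy, hxy]) := by
  subst hx hy; rfl

/-- The iterated identity, allowing equal dimensions. -/
def idle {j k : Dim n} (h : j ≤ k) (x : C.Arr j) : C.Arr k :=
  if h' : j < k then C.idt h' x else (le_antisymm h (not_lt.1 h')) ▸ x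

@[simp] lemma idle_rfl {j : Dim n} (h : j ≤ j) (x : C.Arr j) : C.idle h x = x := by
  simp [idle]

lemma idle_of_lt {j k : Dim n} (h : j < k) (x : C.Arr j) : C.idle h.le x = C.idt h x := by
  simp [idle, h]

/-- The iterated boundary, allowing equal dimensions. -/
def bdle (b : Bool) {j k : Dim n} (h : j ≤ k) (x : C.Arr k) : C.Arr j :=
  if h' : j < k then C.bd b h' x else (le_antisymm h (not_lt.1 h')).symm ▸ x

@[simp] lemma bdle_rfl (b : Bool) {j : Dim n} (h : j ≤ j) (x : C.Arr j) : C.bdle b h x = x := by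
  simp [bdle]

lemma bdle_of_lt (b : Bool) {j k : Dim n} (h : j < k) (x : C.Arr k) :
    C.bdle b h.le x = C.bd b h x := by
  simp [bdle, h]

lemma idt_idle {i j k : Dim n} (h : i ≤ j) (h' : j < k) (x : C.Arr i) :
    C.idt h' (C.idle h x) = C.idle (h.trans h'.le) x := by
  rcases h.eq_or_lt with rfl | h
  · rw [idle_rfl, idle_of_lt]
  · rw [idle_of_lt _ h, idle_of_lt _ (h.trans h'), C.idt_idt]

lemma bd_idle_of_le (b : Bool) {i j k : Dim n} (h : i ≤ j) (h' : j < k) (x : C.Arr i) :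
    C.bd b h' (C.idle (h.trans h'.le) x) = C.idle h x := by
  rw [← idt_idle _ h h', bd_idt]

lemma bd_idle_of_ge (b : Bool) {i j k : Dim n} (h : i < j) (h' : j ≤ k) (x : C.Arr j) :
    C.bd b (h.trans_le h') (C.idle h' x) = C.bd b h x := by
  rcases h'.eq_or_lt with rfl | h'
  · rw [idle_rfl]
  · rw [idle_of_lt _ h', bd_idt_of_lt]

lemma bd_bdle (b b' : Bool) {i j k : Dim n} (h : i < j) (h' : j ≤ k) (x : C.Arr k) :
    C.bd b h (C.bdle b' h' x) = C.bd b (h.trans_le h') x := by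
  rcases h'.eq_or_lt with rfl | h'
  · rw [bdle_rfl]
  · rw [bdle_of_lt _ _ h', bd_bd]

end Basic

/-! ### Functors and isomorphisms -/

section Morphisms

variable {C D E : StrictNCat.{u} n}

@[simp] lemma id_app (k : Dim n) (x : C.Arr k) : Hom.app (𝟙 C) k x = x := rfl

@[simp] lemma comp_app (f : C ⟶ D) (g : D ⟶ E) (k : Dim n) (x : C.Arr k) :
    Hom.app (f ≫ g) k x = g.app k (f.app k x) := rfl

lemma hom_ext {f g : C ⟶ D} (h : ∀ k x, f.app k x = g.app k x) : f = g :=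
  Hom.ext (funext fun k => funext fun x => h k x)

lemma map_bd (f : C ⟶ D) (b : Bool) {j k : Dim n} (h : j < k) (x : C.Arr k) :
    f.app j (C.bd b h x) = D.bd b h (f.app k x) := by
  cases b
  · exact f.map_src h x
  · exact f.map_tgt h x

lemma map_composable (f : C ⟶ D) {j k : Dim n} {h : j < k} {x y : C.Arr k}
    (hxy : C.src h x = C.tgt h y) : D.src h (f.app k x) = D.tgt h (f.app k y) := by
  rw [← f.map_src, ← f.map_tgt, hxy]

lemma map_idle (f : C ⟶ D) {j k : Dim n} (h : j ≤ k) (x : C.Arr j) :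
    f.app k (C.idle h x) = D.idle h (f.app j x) := by
  rcases h.eq_or_lt with rfl | h
  · simp
  · rw [idle_of_lt _ h, idle_of_lt _ h, f.map_idt]

lemma map_bdle (f : C ⟶ D) (b : Bool) {j k : Dim n} (h : j ≤ k) (x : C.Arr k) :
    f.app j (C.bdle b h x) = D.bdle b h (f.app k x) := by
  rcases h.eq_or_lt with rfl | h
  · simp
  · rw [bdle_of_lt _ _ h, bdle_of_lt _ _ h, map_bd]

/-- A functor that is bijective on arrows is an isomorphism. -/
lemma isIso_of_bijective (f : C ⟶ D) (hf : ∀ k, Function.Bijective (f.app k)) : IsIso f := by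
  let g : D ⟶ C :=
    { app := fun k => (Equiv.ofBijective _ (hf k)).symm
      map_src := fun {j k} h x => by
        apply (hf j).1
        rw [f.map_src]
        simp [Equiv.ofBijective_apply_symm_apply]
      map_tgt := fun {j k} h x => by
        apply (hf j).1
        rw [f.map_tgt]
        simp [Equiv.ofBijective_apply_symm_apply]
      map_idt := fun {j k} h x => by
        apply (hf k).1
        rw [f.map_idt]
        simp [Equiv.ofBijective_apply_symm_apply]
      map_comp := fun {j k} h x y hxy hxy' => by
        apply (hf k).1
        rw [f.map_comp _ _ _ _ (map_composable f hxy')]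
        simp [Equiv.ofBijective_apply_symm_apply] }
  refine ⟨g, hom_ext fun k x => ?_, hom_ext fun k x => ?_⟩
  · exact (Equiv.ofBijective _ (hf k)).symm_apply_apply x
  · exact (Equiv.ofBijective _ (hf k)).apply_symm_apply x

lemma bijective_of_isIso (f : C ⟶ D) [IsIso f] (k : Dim n) : Function.Bijective (f.app k) := by
  refine Function.bijective_iff_has_inverse.2 ⟨(inv f).app k, fun x => ?_, fun x => ?_⟩
  · rw [← comp_app, IsIso.hom_inv_id, id_app]
  · rw [← comp_app, IsIso.inv_hom_id, id_app]

end Morphisms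

/-! ### Sub-`n`-categories and products -/

section Sub

/-- A sub-`n`-category: sets of arrows that are closed under the operations. -/
structure Sub (C : StrictNCat.{u} n) where
  mem (k : Dim n) : C.Arr k → Prop
  bd_mem (b : Bool) {j k : Dim n} (h : j < k) (x : C.Arr k) : mem k x → mem j (C.bd b h x)
  idt_mem {j k : Dim n} (h : j < k) (x : C.Arr j) : mem j x → mem k (C.idt h x)
  comp_mem {j k : Dim n} (h : j < k) (x y : C.Arr k) (hxy : C.src h x = C.tgt h y) :
    mem k x → mem k y → mem k (C.comp h x y hxy)

variable {C : StrictNCat.{u} n}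

/-- The strict `n`-category underlying a sub-`n`-category. -/
def Sub.toCat (S : Sub C) : StrictNCat.{u} n where
  Arr k := {x : C.Arr k // S.mem k x}
  src h x := ⟨C.src h x.1, S.bd_mem false h x.1 x.2⟩
  tgt h x := ⟨C.tgt h x.1, S.bd_mem true h x.1 x.2⟩
  idt h x := ⟨C.idt h x.1, S.idt_mem h x.1 x.2⟩
  comp h x y hxy := ⟨C.comp h x.1 y.1 (congrArg Subtype.val hxy), S.comp_mem h _ _ _ x.2 y.2⟩
  src_src _ _ _ := Subtype.ext (C.src_src _ _ _)
  src_tgt _ _ _ := Subtype.ext (C.src_tgt _ _ _)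
  tgt_src _ _ _ := Subtype.ext (C.tgt_src _ _ _)
  tgt_tgt _ _ _ := Subtype.ext (C.tgt_tgt _ _ _)
  src_idt _ _ := Subtype.ext (C.src_idt _ _)
  tgt_idt _ _ := Subtype.ext (C.tgt_idt _ _)
  idt_idt _ _ _ := Subtype.ext (C.idt_idt _ _ _)
  src_comp _ _ _ _ := Subtype.ext (C.src_comp _ _ _ _)
  tgt_comp _ _ _ _ := Subtype.ext (C.tgt_comp _ _ _ _)
  src_comp_of_lt _ _ _ _ _ _ := Subtype.ext (C.src_comp_of_lt _ _ _ _ _ _)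
  tgt_comp_of_lt _ _ _ _ _ _ := Subtype.ext (C.tgt_comp_of_lt _ _ _ _ _ _)
  assoc _ _ _ _ _ _ _ _ := Subtype.ext (C.assoc _ _ _ _ _ _ _ _)
  comp_idt _ _ _ := Subtype.ext (C.comp_idt _ _ _)
  idt_comp _ _ _ := Subtype.ext (C.idt_comp _ _ _)
  idt_comp_idt _ _ _ _ _ _ := Subtype.ext (C.idt_comp_idt _ _ _ _ _ _)
  interchange h h' _ _ _ _ _ _ _ _ _ _ :=
    Subtype.ext (C.interchange h h' _ _ _ _ _ _ _ _ _ _)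

/-- The inclusion of a sub-`n`-category. -/
def Sub.incl (S : Sub C) : S.toCat ⟶ C where
  app k := fun x : {x : C.Arr k // S.mem k x} => x.1
  map_src _ _ := rfl
  map_tgt _ _ := rfl
  map_idt _ _ := rfl
  map_comp _ _ _ _ _ := rfl

/-- A functor with values in a sub-`n`-category. -/
def Sub.lift (S : Sub C) {D : StrictNCat.{u} n} (f : D ⟶ C) (hf : ∀ k x, S.mem k (f.app k x)) :
    D ⟶ S.toCat where
  app k x := (⟨f.app k x, hf k x⟩ : {x : C.Arr k // S.mem k x})
  map_src _ _ := Subtype.ext (f.map_src _ _)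
  map_tgt _ _ := Subtype.ext (f.map_tgt _ _)
  map_idt _ _ := Subtype.ext (f.map_idt _ _)
  map_comp _ _ _ _ hxy' := Subtype.ext (f.map_comp _ _ _ _ (congrArg Subtype.val hxy'))

end Sub

section Prod

/-- The product of two strict `n`-categories. -/
def prod (C D : StrictNCat.{u} n) : StrictNCat.{u} n where
  Arr k := C.Arr k × D.Arr k
  src h x := (C.src h x.1, D.src h x.2)
  tgt h x := (C.tgt h x.1, D.tgt h x.2)
  idt h x := (C.idt h x.1, D.idt h x.2)
  comp h x y hxy := (C.comp h x.1 y.1 (congrArg Prod.fst hxy),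
    D.comp h x.2 y.2 (congrArg Prod.snd hxy))
  src_src _ _ _ := Prod.ext (C.src_src _ _ _) (D.src_src _ _ _)
  src_tgt _ _ _ := Prod.ext (C.src_tgt _ _ _) (D.src_tgt _ _ _)
  tgt_src _ _ _ := Prod.ext (C.tgt_src _ _ _) (D.tgt_src _ _ _)
  tgt_tgt _ _ _ := Prod.ext (C.tgt_tgt _ _ _) (D.tgt_tgt _ _ _)
  src_idt _ _ := Prod.ext (C.src_idt _ _) (D.src_idt _ _)
  tgt_idt _ _ := Prod.ext (C.tgt_idt _ _) (D.tgt_idt _ _)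
  idt_idt _ _ _ := Prod.ext (C.idt_idt _ _ _) (D.idt_idt _ _ _)
  src_comp _ _ _ _ := Prod.ext (C.src_comp _ _ _ _) (D.src_comp _ _ _ _)
  tgt_comp _ _ _ _ := Prod.ext (C.tgt_comp _ _ _ _) (D.tgt_comp _ _ _ _)
  src_comp_of_lt _ _ _ _ _ hs :=
    Prod.ext (C.src_comp_of_lt _ _ _ _ _ (congrArg Prod.fst hs))
      (D.src_comp_of_lt _ _ _ _ _ (congrArg Prod.snd hs))
  tgt_comp_of_lt _ _ _ _ _ hs :=
    Prod.ext (C.tgt_comp_of_lt _ _ _ _ _ (congrArg Prod.fst hs))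
      (D.tgt_comp_of_lt _ _ _ _ _ (congrArg Prod.snd hs))
  assoc _ _ _ _ _ _ _ _ := Prod.ext (C.assoc _ _ _ _ _ _ _ _) (D.assoc _ _ _ _ _ _ _ _)
  comp_idt _ _ _ := Prod.ext (C.comp_idt _ _ _) (D.comp_idt _ _ _)
  idt_comp _ _ _ := Prod.ext (C.idt_comp _ _ _) (D.idt_comp _ _ _)
  idt_comp_idt _ _ _ _ _ _ := Prod.ext (C.idt_comp_idt _ _ _ _ _ _) (D.idt_comp_idt _ _ _ _ _ _)
  interchange h h' _ _ _ _ _ _ _ _ _ _ :=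
    Prod.ext (C.interchange h h' _ _ _ _ _ _ _ _ _ _) (D.interchange h h' _ _ _ _ _ _ _ _ _ _)

variable (C D : StrictNCat.{u} n)

/-- The first projection. -/
def prodFst : C.prod D ⟶ C where
  app k := fun x : C.Arr k × D.Arr k => x.1
  map_src _ _ := rfl
  map_tgt _ _ := rfl
  map_idt _ _ := rfl
  map_comp _ _ _ _ _ := rfl

/-- The second projection. -/
def prodSnd : C.prod D ⟶ D where
  app k := fun x : C.Arr k × D.Arr k => x.2
  map_src _ _ := rfl
  map_tgt _ _ := rfl
  map_idt _ _ := rfl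
  map_comp _ _ _ _ _ := rfl

end Prod

/-! ### Globes, which represent arrows -/

/-- A cell of a globe: a dimension and a sign. -/
@[ext]
structure Cell : Type u where
  dim : ℕ
  sgn : Bool

/-- The `j`-dimensional boundary of a cell. -/
def Cell.bd (b : Bool) (j : ℕ) (c : Cell.{u}) : Cell.{u} := if c.dim ≤ j then c else ⟨j, b⟩

/-- The condition for a cell to be an `m`-arrow of the `k`-globe. -/
def Cell.Valid (k m : ℕ) (c : Cell.{u}) : Prop :=
  -- There is a single cell of dimension `k`; its sign is normalised to `false`.
  c.dim ≤ m ∧ c.dim ≤ k ∧ (c.dim = k → c.sgn = false)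

/-- The globe of dimension `k`: its `m`-arrows are the cells of dimension at most `m`, regarded
as iterated identities. -/
def disk (k : Dim n) : StrictNCat.{u} n where
  Arr m := {c : Cell.{u} // c.Valid k.1 m.1}
  src {j _} _ c := ⟨c.1.bd false j.1, by
    have := c.2; grind [Cell.bd, Cell.Valid]⟩
  tgt {j _} _ c := ⟨c.1.bd true j.1, by
    have := c.2; grind [Cell.bd, Cell.Valid]⟩
  idt {j m} h c := ⟨c.1, by
    have h' : j.1 < m.1 := h
    have := c.2; grind [Cell.bd, Cell.Valid]⟩
  -- Of two arrows composable in dimension `j`, at least one is the identity of a `j`-arrow, because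
  -- two cells of dimension above `j` have `j`-source of sign `false` and `j`-target of sign `true`.
  comp {j _} _ x y _ := if x.1.dim ≤ j.1 then y else x
  src_src {i j _} h _ _ := Subtype.ext (by
    have h' : i.1 < j.1 := h
    grind [Cell.bd])
  src_tgt {i j _} h _ _ := Subtype.ext (by
    have h' : i.1 < j.1 := h
    grind [Cell.bd])
  tgt_src {i j _} h _ _ := Subtype.ext (by
    have h' : i.1 < j.1 := h
    grind [Cell.bd])
  tgt_tgt {i j _} h _ _ := Subtype.ext (by
    have h' : i.1 < j.1 := h
    grind [Cell.bd])
  src_idt {j _} h x := Subtype.ext (by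
    have := x.2
    grind [Cell.bd, Cell.Valid])
  tgt_idt {j _} h x := Subtype.ext (by
    have := x.2
    grind [Cell.bd, Cell.Valid])
  idt_idt _ _ _ := rfl
  src_comp {j k} h x y hxy := by
    have := congrArg Subtype.val hxy
    apply Subtype.ext
    split_ifs <;> grind [Cell.bd]
  tgt_comp {j k} h x y hxy := by
    have := congrArg Subtype.val hxy
    apply Subtype.ext
    split_ifs <;> grind [Cell.bd]
  src_comp_of_lt {i j _} h _ x y hxy _ := by
    have h' : i.1 < j.1 := h
    have := congrArg Subtype.val hxy
    apply Subtype.ext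
    grind [Cell.bd]
  tgt_comp_of_lt {i j _} h _ x y hxy _ := by
    have h' : i.1 < j.1 := h
    have := congrArg Subtype.val hxy
    apply Subtype.ext
    grind [Cell.bd]
  assoc _ _ _ _ _ _ _ _ := by split_ifs <;> rfl
  comp_idt {j _} h x hx := by
    apply Subtype.ext
    grind [Cell.bd]
  idt_comp {j _} h x hx := by
    apply Subtype.ext
    grind [Cell.bd]
  idt_comp_idt _ _ _ _ _ _ := by
    apply Subtype.ext
    grind
  interchange {i j _} h _ x y z w hxy hzw hxz hyw _ _ := by
    have h' : i.1 < j.1 := h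
    have h1 := congrArg Subtype.val hxy
    have h2 := congrArg Subtype.val hzw
    have h3 := congrArg Subtype.val hxz
    have h4 := congrArg Subtype.val hyw
    apply Subtype.ext
    grind [Cell.bd]

section Disk

variable {k : Dim n}

/-- The cell underlying an arrow of a globe. -/
def cell {m : Dim n} (c : (disk.{u} k).Arr m) : Cell.{u} := Subtype.val c

lemma cell_valid {m : Dim n} (c : (disk.{u} k).Arr m) : (cell c).Valid k.1 m.1 := Subtype.prop c

lemma cell_injective {m : Dim n} {c d : (disk.{u} k).Arr m} (h : cell c = cell d) : c = d :=
  Subtype.ext h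

/-- The arrow of a globe given by a cell. -/
def ofCell {m : Dim n} (c : Cell.{u}) (hc : c.Valid k.1 m.1) : (disk.{u} k).Arr m := ⟨c, hc⟩

@[simp] lemma cell_ofCell {m : Dim n} (c : Cell.{u}) (hc : c.Valid k.1 m.1) :
    cell (ofCell c hc) = c := rfl

@[simp] lemma cell_src {j m : Dim n} (h : j < m) (c : (disk.{u} k).Arr m) :
    cell ((disk k).src h c) = (cell c).bd false j.1 := rfl

@[simp] lemma cell_tgt {j m : Dim n} (h : j < m) (c : (disk.{u} k).Arr m) :
    cell ((disk k).tgt h c) = (cell c).bd true j.1 := rfl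

lemma cell_bd (b : Bool) {j m : Dim n} (h : j < m) (c : (disk.{u} k).Arr m) :
    cell ((disk k).bd b h c) = (cell c).bd b j.1 := by cases b <;> rfl

@[simp] lemma cell_idt {j m : Dim n} (h : j < m) (c : (disk.{u} k).Arr j) :
    cell ((disk k).idt h c) = cell c := rfl

lemma cell_comp {j m : Dim n} (h : j < m) (c d : (disk.{u} k).Arr m)
    (hcd : (disk k).src h c = (disk k).tgt h d) :
    cell ((disk k).comp h c d hcd) = if (cell c).dim ≤ j.1 then cell d else cell c := by
  split_ifs with hc
  · exact congrArg cell (if_pos hc)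
  · exact congrArg cell (if_neg hc)

/-- The nondegenerate arrow of dimension `k` of the `k`-globe. -/
def top (k : Dim n) : (disk.{u} k).Arr k := ofCell ⟨k.1, false⟩ ⟨le_rfl, le_rfl, fun _ => rfl⟩

@[simp] lemma cell_top : cell (top.{u} k) = ⟨k.1, false⟩ := rfl

lemma eq_top {c : (disk.{u} k).Arr k} (h : k.1 ≤ (cell c).dim) : c = top k := by
  have := cell_valid c
  apply cell_injective
  ext <;> grind [Cell.Valid, cell_top]

variable {C D : StrictNCat.{u} n}

/-- The value at a cell of the functor that a `k`-arrow defines on the `k`-globe. -/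
def evalCell (x : C.Arr k) {m : Dim n} (c : Cell.{u}) (hc : c.Valid k.1 m.1) : C.Arr m :=
  C.idle (j := ⟨c.dim, (Nat.cast_le.2 hc.1).trans m.2⟩) (k := m) hc.1
    (C.bdle c.sgn (k := k) hc.2.1 x)

lemma evalCell_congr (x : C.Arr k) {m : Dim n} {c d : Cell.{u}} (h : c = d)
    (hc : c.Valid k.1 m.1) : evalCell x c hc = evalCell x d (h ▸ hc) := by
  subst h; rfl

lemma bd_evalCell (b : Bool) (x : C.Arr k) {j m : Dim n} (h : j < m) (c : Cell.{u})
    (hc : c.Valid k.1 m.1) (hc' : (c.bd b j.1).Valid k.1 j.1) :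
    C.bd b h (evalCell x c hc) = evalCell x (c.bd b j.1) hc' := by
  by_cases hj : c.dim ≤ j.1
  · have e : c.bd b j.1 = c := if_pos hj
    rw [evalCell_congr x e]
    exact C.bd_idle_of_le b _ h _
  · have e : c.bd b j.1 = ⟨j.1, b⟩ := if_neg hj
    rw [evalCell_congr x e]
    have hjk : j < k := lt_of_lt_of_le (b := c.dim) (not_le.1 hj) hc.2.1
    have hjd : j < (⟨c.dim, (Nat.cast_le.2 hc.1).trans m.2⟩ : Dim n) := not_le.1 hj
    refine (C.bd_idle_of_ge b hjd _ _).trans ((C.bd_bdle b c.sgn hjd hc.2.1 x).trans ?_)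
    exact ((C.idle_rfl _ _).trans (C.bdle_of_lt b hjk x)).symm

lemma idt_evalCell (x : C.Arr k) {j m : Dim n} (h : j < m) (c : Cell.{u})
    (hc : c.Valid k.1 j.1) (hc' : c.Valid k.1 m.1) :
    C.idt h (evalCell x c hc) = evalCell x c hc' := C.idt_idle _ h _

/-- The functor on the `k`-globe defined by a `k`-arrow. -/
def ofArr (x : C.Arr k) : disk.{u} k ⟶ C where
  app m c := evalCell x (cell c) (cell_valid c)
  map_src h c := (bd_evalCell false x h (cell c) _ _).symm
  map_tgt h c := (bd_evalCell true x h (cell c) _ _).symm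
  map_idt h c := (idt_evalCell x h (cell c) _ _).symm
  map_comp {j m} h c d hcd hcd' := by
    by_cases hc : (cell c).dim ≤ j.1
    · have e : (disk k).comp h c d hcd = d := if_pos hc
      rw [e]
      have hv : (cell c).Valid k.1 j.1 := ⟨hc, (cell_valid c).2⟩
      exact (C.comp_of_left_eq_idt h hcd' (idt_evalCell x h (cell c) hv (cell_valid c)).symm).symm
    · have e : (disk k).comp h c d hcd = c := if_neg hc
      rw [e]
      have hd : (cell d).dim ≤ j.1 := by
        have := congrArg cell hcd
        simp only [cell_src, cell_tgt, Cell.bd] at this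
        grind
      have hv : (cell d).Valid k.1 j.1 := ⟨hd, (cell_valid d).2⟩
      exact (C.comp_of_right_eq_idt h hcd' (idt_evalCell x h (cell d) hv (cell_valid d)).symm).symm

@[simp] lemma ofArr_top (x : C.Arr k) : (ofArr x).app k (top k) = x :=
  (C.idle_rfl (le_refl k) _).trans (C.bdle_rfl false (le_refl k) x)

/-- Every arrow of the globe is an iterated identity of an iterated boundary of `top k`. This is the
uniqueness half of representability. -/
lemma evalCell_top {m : Dim n} (c : (disk.{u} k).Arr m) :
    evalCell (top k) (cell c) (cell_valid c) = c := by
  have hv := cell_valid c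
  apply cell_injective
  have h1 : ∀ (i : Dim n) (h : i ≤ k) (b : Bool), (i = k → b = false) →
      cell ((disk.{u} k).bdle b h (top k)) = ⟨i.1, b⟩ := by
    intro i h b hb
    rcases h.eq_or_lt with rfl | h'
    · simp [hb]
    · rw [bdle_of_lt _ _ h', cell_bd, Cell.bd, if_neg]
      exact not_le.2 (show i.1 < k.1 from h')
  have h2 : ∀ (i j : Dim n) (h : i ≤ j) (c : (disk.{u} k).Arr i),
      cell ((disk k).idle h c) = cell c := by
    intro i j h c
    rcases h.eq_or_lt with rfl | h'
    · simp
    · rw [idle_of_lt _ h', cell_idt]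
  rw [evalCell, h2, h1]
  intro h
  apply hv.2.2
  exact congrArg Subtype.val h

lemma app_evalCell (f : C ⟶ D) (x : C.Arr k) {m : Dim n} (c : Cell.{u}) (hc : c.Valid k.1 m.1) :
    f.app m (evalCell x c hc) = evalCell (f.app k x) c hc := by
  rw [evalCell, map_idle, map_bdle]; rfl

lemma ofArr_app_top (f : disk.{u} k ⟶ C) : ofArr (f.app k (top k)) = f := by
  refine hom_ext fun m c => ?_
  conv_rhs => rw [← evalCell_top c, app_evalCell]
  rfl

end Disk

/-! ### Degenerate arrows and truncation -/

section Degenerate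

/-- An arrow is degenerate above `l` if it has dimension at most `l` or is the identity of
an `l`-arrow. -/
def Deg {C : StrictNCat.{u} n} (l : Dim n) {m : Dim n} (z : C.Arr m) : Prop :=
  m ≤ l ∨ ∃ (h : l < m) (w : C.Arr l), z = C.idt h w

/-- The sub-`n`-category of arrows degenerate above `l`. -/
def degSub (C : StrictNCat.{u} n) (l : Dim n) : Sub C where
  mem _ z := Deg l z
  bd_mem b {i m} h z hz := by
    rcases hz with hz | ⟨hl, w, rfl⟩
    · exact Or.inl (h.le.trans hz)
    · by_cases hi : i ≤ l
      · exact Or.inl hi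
      · exact Or.inr ⟨not_le.1 hi, w, C.bd_idt_of_gt b (not_le.1 hi) h w⟩
  idt_mem {i m} h z hz := by
    rcases hz with hz | ⟨hl, w, rfl⟩
    · by_cases hm : m ≤ l
      · exact Or.inl hm
      · exact Or.inr ⟨not_le.1 hm, C.idle hz z, by
          rw [C.idt_idle hz (not_le.1 hm), C.idle_of_lt h]⟩
    · exact Or.inr ⟨hl.trans h, w, C.idt_idt _ _ _⟩
  comp_mem {i m} h x y hxy hx hy := by
    rcases hx with hx | ⟨hl, w, rfl⟩
    · exact Or.inl hx
    · rcases hy with hy | ⟨_, w', rfl⟩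
      · exact Or.inl hy
      · rcases lt_trichotomy i l with hi | rfl | hi
        · refine Or.inr ⟨hl, C.comp hi w w' ?_, ?_⟩
          · rw [← bd_false, ← bd_true, ← C.bd_idt_of_lt false hi hl, ← C.bd_idt_of_lt true hi hl,
              bd_false, bd_true, hxy]
          · exact (C.idt_comp_idt hi hl w w' _ _).symm
        · exact Or.inr ⟨hl, w', C.comp_of_left_eq_idt _ _ rfl⟩
        · refine Or.inr ⟨hl, w', C.comp_of_left_eq_idt h hxy (w := C.idt hi w) ?_⟩
          rw [C.idt_idt]

/-- If all `(l+1)`-arrows of `C` are loops, then `C` has an endofunctor that replaces all arrows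
of dimension greater than `l` by the identities of their `l`-sources. -/
def truncHom (C : StrictNCat.{u} n) (l : Dim n)
    (hC : ∀ (m : Dim n) (h : l < m) (x : C.Arr m), C.src h x = C.tgt h x) : C ⟶ C :=
  have hC' (b : Bool) {m : Dim n} (h : l < m) (x : C.Arr m) : C.src h x = C.bd b h x := by
    cases b
    · rfl
    · exact hC m h x
  -- The loop hypothesis matters only at `i = l`: the truncated arrow has the `l`-source of `x` as
  -- its `l`-target too.
  have key (b : Bool) {i m : Dim n} (h : i < m) (x : C.Arr m) :
      (if h' : l < i then C.idt h' (C.src h' (C.bd b h x)) else C.bd b h x) =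
        C.bd b h (if h' : l < m then C.idt h' (C.src h' x) else x) := by
    by_cases hi : l < i
    · simp only [hi, hi.trans h, dite_true]
      rw [C.bd_idt_of_gt b hi h, C.src_bd]
    · by_cases hm : l < m
      · simp only [hi, hm, dite_true, dite_false]
        rcases (not_lt.1 hi).eq_or_lt with rfl | hi'
        · rw [C.bd_idt, hC' b]
        · rw [C.bd_idt_of_lt b hi' hm, ← bd_false, C.bd_bd]
      · simp only [hi, hm, dite_false]
  { app := fun m z => if h : l < m then C.idt h (C.src h z) else z
    map_src := fun h x => key false h x
    map_tgt := fun h x => key true h x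
    map_idt := fun {i m} h x => by
      by_cases hi : l < i
      · simp only [hi, hi.trans h, dite_true]
        rw [← bd_false _ (hi.trans h), C.bd_idt_of_lt false hi h, C.idt_idt]; rfl
      · by_cases hm : l < m
        · simp only [hi, hm, dite_true, dite_false]
          rcases (not_lt.1 hi).eq_or_lt with rfl | hi'
          · rw [C.src_idt]
          · rw [← C.idt_idt hi' hm, C.src_idt]
        · simp only [hi, hm, dite_false]
    map_comp := fun {i m} h x y hxy hxy' => by
      by_cases hm : l < m
      · simp only [hm, dite_true] at hxy' ⊢
        rcases lt_trichotomy i l with hi | rfl | hi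
        · have hc : C.src hi (C.src hm x) = C.tgt hi (C.src hm y) := by
            rw [C.src_src, C.tgt_src, hxy]
          rw [C.src_comp_of_lt hi hm x y hxy hc, C.idt_comp_idt hi hm _ _ hc]
        · rw [C.comp_of_left_eq_idt _ _ rfl, C.src_comp]
        · rw [C.comp_of_left_eq_idt h hxy' (C.idt_idt hi h _).symm, ← bd_false,
            C.bd_comp_of_gt_right false hi h, bd_false]
      · simp only [hm, dite_false] }

lemma truncHom_app_of_le (C : StrictNCat.{u} n) (l : Dim n)
    (hC : ∀ (m : Dim n) (h : l < m) (x : C.Arr m), C.src h x = C.tgt h x) {m : Dim n} (h : m ≤ l)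
    (x : C.Arr m) : (truncHom C l hC).app m x = x := dif_neg (not_lt.2 h)

lemma deg_truncHom_app (C : StrictNCat.{u} n) (l : Dim n)
    (hC : ∀ (m : Dim n) (h : l < m) (x : C.Arr m), C.src h x = C.tgt h x) {m : Dim n}
    (x : C.Arr m) : Deg l ((truncHom C l hC).app m x) := by
  by_cases h : l < m
  · exact Or.inr ⟨h, C.src h x, dif_pos h⟩
  · exact Or.inl (not_lt.1 h)

lemma Deg.map {C D : StrictNCat.{u} n} {l m : Dim n} {z : C.Arr m} (hz : Deg l z) (f : C ⟶ D) :
    Deg l (f.app m z) := by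
  rcases hz with hz | ⟨h, w, rfl⟩
  · exact Or.inl hz
  · exact Or.inr ⟨h, f.app l w, f.map_idt h w⟩

lemma not_deg_top {l k : Dim n} (h : l < k) : ¬ Deg l (top.{u} k) := by
  rintro (h' | ⟨_, w, hw⟩)
  · exact absurd h (not_lt.2 h')
  · have h1 := (cell_valid w).1
    have h2 : l.1 < k.1 := h
    rw [← cell_idt h w, ← hw, cell_top] at h1
    exact absurd h2 (not_lt.2 h1)

end Degenerate

/-! ### Admissible classes, faces of globes and parallel arrows -/

/-- The closure properties of a class of strict `n`-categories under which its autoequivalences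
can be determined. -/
class Admissible (P : ObjectProperty (StrictNCat.{u} n)) : Prop where
  disk (k : Dim n) : P (disk k)
  sub {C : StrictNCat.{u} n} (S : Sub C) : P C → P S.toCat
  prod {C D : StrictNCat.{u} n} : P C → P D → P (C.prod D)
  op (δ : Signs n) {C : StrictNCat.{u} n} : P C → P (C.op δ)

variable (P : ObjectProperty (StrictNCat.{u} n))

/-- The `k`-globe as an object of an admissible class. -/
abbrev globe [Admissible P] (k : Dim n) : P.FullSubcategory := ⟨disk k, Admissible.disk k⟩

variable {P}
variable {C D : P.FullSubcategory}

lemma mono_of_injective (f : C ⟶ D) (hf : ∀ k, Function.Injective (f.hom.app k)) : Mono f where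
  right_cancellation g h hgh := ObjectProperty.hom_ext _ (hom_ext fun k x => hf k (by
    have := congrArg (fun φ => Hom.app φ.hom k x) hgh
    exact this))

lemma app_bijective_of_isIso (f : C ⟶ D) [IsIso f] (k : Dim n) :
    Function.Bijective (f.hom.app k) := bijective_of_isIso f.hom k

variable [Admissible P]

/-- The `k`-arrow corresponding to a functor on the `k`-globe. -/
def arr {k : Dim n} (f : globe P k ⟶ C) : C.obj.Arr k := f.hom.app k (top k)

/-- The functor on the `k`-globe corresponding to a `k`-arrow. -/
def pt {k : Dim n} (x : C.obj.Arr k) : globe P k ⟶ C := ObjectProperty.homMk (ofArr x)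

@[simp] lemma arr_pt {k : Dim n} (x : C.obj.Arr k) : arr (pt x) = x := ofArr_top x

@[simp] lemma pt_arr {k : Dim n} (f : globe P k ⟶ C) : pt (arr f) = f :=
  ObjectProperty.hom_ext _ (ofArr_app_top f.hom)

lemma arr_injective {k : Dim n} {f g : globe P k ⟶ C} (h : arr f = arr g) : f = g := by
  rw [← pt_arr f, h, pt_arr]

lemma arr_comp {k : Dim n} (f : globe P k ⟶ C) (g : C ⟶ D) :
    arr (f ≫ g) = g.hom.app k (arr f) := rfl

lemma pt_comp {k : Dim n} (x : C.obj.Arr k) (g : C ⟶ D) : pt x ≫ g = pt (g.hom.app k x) :=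
  arr_injective (by rw [arr_comp, arr_pt, arr_pt])

lemma app_injective_of_mono (f : C ⟶ D) [Mono f] (k : Dim n) :
    Function.Injective (f.hom.app k) := by
  intro x y hxy
  have : pt x ≫ f = pt y ≫ f := by rw [pt_comp, pt_comp, hxy]
  rw [← arr_pt x, (cancel_mono f).1 this, arr_pt]

/-- The inclusion of a face of a globe. -/
def face (P : ObjectProperty (StrictNCat.{u} n)) [Admissible P] (b : Bool) {l k : Dim n}
    (h : l < k) : globe P l ⟶ globe P k := pt ((disk k).bd b h (top k))

lemma face_pt (b : Bool) {l k : Dim n} (h : l < k) (x : C.obj.Arr k) :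
    face P b h ≫ pt x = pt (C.obj.bd b h x) := by
  rw [face, pt_comp]
  congr 1
  exact (map_bd (ofArr x) b h (top k)).trans (by rw [ofArr_top])

lemma face_comp (b : Bool) {l k : Dim n} (h : l < k) (f : globe P k ⟶ C) :
    face P b h ≫ f = pt (C.obj.bd b h (arr f)) := by
  rw [← face_pt, pt_arr]

lemma arr_face_comp (b : Bool) {l k : Dim n} (h : l < k) (f : globe P k ⟶ C) :
    arr (face P b h ≫ f) = C.obj.bd b h (arr f) := by
  rw [face_comp, arr_pt]

/-- Two functors on the `l`-globe are parallel if they agree on the globes of lower dimension. -/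
def Par {l : Dim n} (f g : globe P l ⟶ C) : Prop :=
  ∀ ⦃i : Dim n⦄, i < l → ∀ z : globe P i ⟶ globe P l, z ≫ f = z ≫ g

lemma Par.comp {l : Dim n} {f g : globe P l ⟶ C} (h : Par f g) (φ : C ⟶ D) :
    Par (f ≫ φ) (g ≫ φ) := fun i hi z => by
  rw [← Category.assoc, h hi z, Category.assoc]

lemma par_of_bd_eq {l : Dim n} {f g : globe P l ⟶ C}
    (h : ∀ (b : Bool) (i : Dim n) (hi : i < l),
      C.obj.bd b hi (arr f) = C.obj.bd b hi (arr g)) : Par f g := by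
  intro i hi z
  apply arr_injective
  rw [← pt_arr f, ← pt_arr g, arr_comp, arr_comp]
  change evalCell (arr f) (cell (arr z)) (cell_valid (arr z)) =
    evalCell (arr g) (cell (arr z)) (cell_valid (arr z))
  have hc : (cell (arr z)).dim ≤ i.1 := (cell_valid (arr z)).1
  unfold evalCell
  have hd : (⟨(cell (arr z)).dim, (Nat.cast_le.2 hc).trans i.2⟩ : Dim n) < l :=
    lt_of_le_of_lt (b := i) hc hi
  rw [C.obj.bdle_of_lt _ hd, C.obj.bdle_of_lt _ hd, h]

lemma Par.bd_eq {l : Dim n} {f g : globe P l ⟶ C} (h : Par f g) (b : Bool) {i : Dim n}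
    (hi : i < l) : C.obj.bd b hi (arr f) = C.obj.bd b hi (arr g) := by
  rw [← arr_face_comp, ← arr_face_comp, h hi]

lemma par_face {l k : Dim n} (h : l < k) : Par (face P false h) (face P true h) := by
  apply par_of_bd_eq
  intro b i hi
  rw [face, face, arr_pt, arr_pt, StrictNCat.bd_bd, StrictNCat.bd_bd]

lemma cell_arr_face (b : Bool) {l k : Dim n} (h : l < k) :
    cell (arr (face P b h)) = ⟨l.1, b⟩ := by
  rw [face, arr_pt]
  exact (cell_bd b h (top k)).trans (if_neg (not_le.2 (show l.1 < k.1 from h)))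

lemma face_ne {l k : Dim n} (h : l < k) : face P false h ≠ face P true h := by
  intro he
  have := congrArg (fun f => (cell (arr f)).sgn) he
  simp [cell_arr_face] at this

/-- Two distinct parallel `l`-arrows of the `(l+1)`-globe are its two faces. -/
lemma Par.eq_face {l k : Dim n} (h : l < k) {f g : globe P l ⟶ globe P k}
    (hp : Par f g) (hne : f ≠ g) :
    (f = face P false h ∧ g = face P true h) ∨ (f = face P true h ∧ g = face P false h) := by
  -- If the cell of `f` has dimension `d < l`, it equals both of its `d`-boundaries, hence both
  -- `d`-boundaries of `g`. These have opposite signs if the cell of `g` has dimension above `d`; so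
  -- the two cells coincide.
  have hlt : ∀ {f g : globe P l ⟶ globe P k}, Par f g → f ≠ g → (cell (arr f)).dim = l.1 := by
    intro f g hp hne
    by_contra hd
    have hfv : (cell (arr f)).dim ≤ l.1 := (cell_valid (arr f)).1
    have hi : (cell (arr f)).dim < l.1 := lt_of_le_of_ne hfv hd
    let i : Dim n := ⟨(cell (arr f)).dim, (Nat.cast_le.2 hfv).trans l.2⟩
    have hil : i < l := hi
    have h0 := congrArg cell (hp.bd_eq false hil)
    have h1 := congrArg cell (hp.bd_eq true hil)
    have h0' := (cell_bd false hil (arr f)).symm.trans (h0.trans (cell_bd false hil (arr g)))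
    have h1' := (cell_bd true hil (arr f)).symm.trans (h1.trans (cell_bd true hil (arr g)))
    have : cell (arr f) = cell (arr g) := by
      change Cell.bd _ (cell (arr f)).dim _ = Cell.bd _ (cell (arr f)).dim _ at h0' h1'
      grind [Cell.bd]
    exact hne (arr_injective (cell_injective this))
  have hf := hlt hp hne
  have hg := hlt (f := g) (g := f) (fun i hi z => (hp hi z).symm) hne.symm
  have hs : (cell (arr f)).sgn ≠ (cell (arr g)).sgn := fun hs =>
    hne (arr_injective (cell_injective (Cell.ext (hf.trans hg.symm) hs)))
  have he : ∀ (f : globe P l ⟶ globe P k) (b : Bool), (cell (arr f)).dim = l.1 →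
      (cell (arr f)).sgn = b → f = face P b h := fun f b h1 h2 =>
    arr_injective (cell_injective ((Cell.ext h1 h2).trans (cell_arr_face b h).symm))
  cases hb : (cell (arr f)).sgn <;> cases hb' : (cell (arr g)).sgn
  · exact absurd (hb.trans hb'.symm) hs
  · exact Or.inl ⟨he _ _ hf hb, he _ _ hg hb'⟩
  · exact Or.inr ⟨he _ _ hf hb, he _ _ hg hb'⟩
  · exact absurd (hb.trans hb'.symm) hs

/-- The only `(l+1)`-arrow of the `(l+1)`-globe that is not a loop is the nondegenerate one. -/
lemma eq_top_of_bd_ne {l k : Dim n} (h : l < k) (hk : k.1 = l.1 + 1) {c : (disk.{u} k).Arr k}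
    (hc : (disk k).src h c ≠ (disk k).tgt h c) : c = top k := by
  apply eq_top
  by_contra hd
  apply hc
  apply cell_injective
  rw [cell_src, cell_tgt, Cell.bd, Cell.bd, if_pos (by omega), if_pos (by omega)]

/-- Keeping the two faces apart means that the image of the top arrow is not a loop, and the top
arrow is the only such `k`-arrow. -/
lemma endo_eq_id {l k : Dim n} (h : l < k) (hk : k.1 = l.1 + 1) {φ : globe P k ⟶ globe P k}
    (hφ : face P false h ≫ φ ≠ face P true h ≫ φ) : φ = 𝟙 _ := by
  apply arr_injective
  refine eq_top_of_bd_ne h hk fun he => hφ (arr_injective ?_)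
  rw [arr_face_comp, arr_face_comp]
  exact he

/-! ### Autoequivalences fix the globes -/

section Equivalence

variable (F : P.FullSubcategory ⥤ P.FullSubcategory)

/-- The degenerate arrows of `F C` form a subobject, which comes from a subobject `S'` of `C`. The
latter contains all arrows of dimension at most `l`, since the globes that detect them are fixed by
`F`; as `C` has only degenerate arrows, `S'` is all of `C`. -/
lemma deg_obj [F.IsEquivalence] {l : Dim n}
    (e : ∀ j ≤ l, Nonempty (F.obj (globe P j) ≅ globe P j))
    (hC : ∀ (m : Dim n) (z : C.obj.Arr m), Deg l z) (m : Dim n) (z : (F.obj C).obj.Arr m) :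
    Deg l z := by
  let S : P.FullSubcategory := ⟨(degSub (F.obj C).obj l).toCat, Admissible.sub _ (F.obj C).2⟩
  let i : S ⟶ F.obj C := ObjectProperty.homMk (degSub (F.obj C).obj l).incl
  have hi : Mono i := mono_of_injective i fun k x y hxy => Subtype.ext hxy
  obtain ⟨S', ⟨a⟩⟩ := Functor.EssSurj.mem_essImage (F := F) S
  let φ : S' ⟶ C := F.preimage (a.hom ≫ i)
  have hφ : F.map φ = a.hom ≫ i := F.map_preimage _
  have : Mono (F.map φ) := by rw [hφ]; infer_instance
  have : Mono φ := F.mono_of_mono_map this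
  -- The image of `x` under `F` is an `m`-arrow of `F C` with `m ≤ l`, hence factors through the
  -- subobject of degenerate arrows; fullness brings the factorisation back to `C`.
  have lift (m : Dim n) (hm : m ≤ l) (x : C.obj.Arr m) : ∃ y, φ.hom.app m y = x := by
    obtain ⟨em⟩ := e m hm
    let x' := em.inv ≫ F.map (pt x)
    let w : globe P m ⟶ S := pt (C := S) (⟨arr x', Or.inl hm⟩ : {z // Deg l z})
    have hw : w ≫ i = x' := arr_injective
      (congrArg Subtype.val (arr_pt (C := S) (⟨arr x', Or.inl hm⟩ : {z // Deg l z})))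
    let y : globe P m ⟶ S' := F.preimage (em.hom ≫ w ≫ a.inv)
    have hy : y ≫ φ = pt x := by
      apply F.map_injective
      simp [y, hφ, hw, x']
    exact ⟨arr y, by rw [← arr_comp, hy, arr_pt]⟩
  have : IsIso φ := by
    rw [← ObjectProperty.isIso_hom_iff]
    refine isIso_of_bijective _ fun m => ⟨app_injective_of_mono φ m, fun x => ?_⟩
    rcases hC m x with hm | ⟨h, w, rfl⟩
    · exact lift m hm x
    · obtain ⟨y, rfl⟩ := lift l le_rfl w
      exact ⟨S'.obj.idt h y, φ.hom.map_idt h y⟩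
  have : IsIso i := by
    have : i = a.inv ≫ F.map φ := by rw [hφ, Iso.inv_hom_id_assoc]
    rw [this]; infer_instance
  obtain ⟨y, rfl⟩ := (app_bijective_of_isIso i m).2 z
  exact y.2

/-- Parallelism is tested by maps between globes of dimension at most `l`, and by fullness every
test map on the side of the images comes from one between the original globes. -/
lemma par_map {l : Dim n} (e : ∀ j ≤ l, F.obj (globe P j) ≅ globe P j) [F.Full]
    {f g : globe P l ⟶ C} (h : Par f g) :
    Par ((e l le_rfl).inv ≫ F.map f) ((e l le_rfl).inv ≫ F.map g) := by
  intro i hi z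
  let z' := F.preimage ((e i hi.le).hom ≫ z ≫ (e l le_rfl).inv)
  have hz : z ≫ (e l le_rfl).inv = (e i hi.le).inv ≫ F.map z' := by simp [z']
  simp only [reassoc_of% hz, ← F.map_comp, h hi]

lemma par_of_par_map {l : Dim n} (e : ∀ j ≤ l, F.obj (globe P j) ≅ globe P j) [F.Faithful]
    {f g : globe P l ⟶ C}
    (h : Par ((e l le_rfl).inv ≫ F.map f) ((e l le_rfl).inv ≫ F.map g)) : Par f g := by
  intro i hi z
  apply F.map_injective
  have := h hi ((e i hi.le).inv ≫ F.map z ≫ (e l le_rfl).hom)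
  simpa using this

/-- The globe `D_{l+1}` has an image under an equivalence that contains an arrow which is
not a loop. -/
lemma exists_nonloop (E : P.FullSubcategory ≌ P.FullSubcategory) {l k : Dim n} (h : l < k)
    (hk : k.1 = l.1 + 1) (e : ∀ j ≤ l, Nonempty (E.functor.obj (globe P j) ≅ globe P j))
    (e' : ∀ j ≤ l, Nonempty (E.inverse.obj (globe P j) ≅ globe P j)) :
    ∃ f : globe P k ⟶ E.functor.obj (globe P k), face P false h ≫ f ≠ face P true h ≫ f := by
  by_contra! hcon
  let X := E.functor.obj (globe P k)
  -- The `l`-boundary of an arrow of dimension above `l` is that of its `k`-dimensional boundary,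
  -- because `k = l + 1`.
  have hloop (m : Dim n) (hm : l < m) (x : X.obj.Arr m) : X.obj.src hm x = X.obj.tgt hm x := by
    have hkm : k ≤ m := show k.1 ≤ m.1 from hk ▸ (show l.1 < m.1 from hm)
    have h1 := congrArg arr (hcon (pt (X.obj.bdle false hkm x)))
    rw [arr_face_comp, arr_face_comp, arr_pt] at h1
    exact (X.obj.bd_bdle false false h hkm x).symm.trans
      (h1.trans (X.obj.bd_bdle true false h hkm x))
  let t : X ⟶ X := ObjectProperty.homMk (truncHom X.obj l hloop)
  have ht (f : E.functor.obj (globe P l) ⟶ X) : f ≫ t = f := by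
    obtain ⟨el⟩ := e l le_rfl
    rw [← cancel_epi el.inv]
    apply arr_injective
    rw [← Category.assoc, arr_comp]
    exact truncHom_app_of_le _ _ hloop le_rfl _
  let φ := E.functor.preimage t
  -- The truncation `t` fixes the `l`-arrows of `X`, so its preimage fixes both faces of `D_k`. Thus
  -- `t` is the identity and all of `X` is degenerate above `l`; by `deg_obj` for the inverse
  -- equivalence the same holds for `D_k`, which is absurd.
  have hφ : φ = 𝟙 _ := by
    apply endo_eq_id h hk
    have : ∀ b, face P b h ≫ φ = face P b h := fun b => E.functor.map_injective (by simp [φ, ht])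
    rw [this, this]
    exact face_ne h
  have ht1 : t = 𝟙 _ := by
    rw [← E.functor.map_preimage t]
    exact (congrArg E.functor.map hφ).trans (E.functor.map_id _)
  have hX (m : Dim n) (z : X.obj.Arr m) : Deg l z := by
    have h1 := deg_truncHom_app X.obj l hloop z
    have h2 : (truncHom X.obj l hloop).app m z = z :=
      congrArg (fun f : X ⟶ X => f.hom.app m z) ht1
    rwa [h2] at h1
  let η : E.inverse.obj X ≅ globe P k := (E.unitIso.app (globe P k)).symm
  obtain ⟨y, hy⟩ := (app_bijective_of_isIso η.hom k).2 (top k)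
  have := (deg_obj E.inverse e' hX k y).map η.hom.hom
  rw [hy] at this
  exact not_deg_top h this

/-- `exists_nonloop`, applied to `E` and to its inverse, gives maps `f` and `g` in opposite
directions. Both round trips, read as endomorphisms of `D_k`, keep the faces apart, because distinct
parallel `l`-arrows of `D_k` are its faces in some order; hence both are identities. -/
lemma globe_iso_step (E : P.FullSubcategory ≌ P.FullSubcategory) {l k : Dim n} (h : l < k)
    (hk : k.1 = l.1 + 1) (e : ∀ j ≤ l, Nonempty (E.functor.obj (globe P j) ≅ globe P j))
    (e' : ∀ j ≤ l, Nonempty (E.inverse.obj (globe P j) ≅ globe P j)) :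
    Nonempty (E.functor.obj (globe P k) ≅ globe P k) := by
  obtain ⟨f, hf⟩ := exists_nonloop E h hk e e'
  obtain ⟨g, hg⟩ : ∃ g : E.functor.obj (globe P k) ⟶ globe P k,
      E.functor.map (face P false h) ≫ g ≠ E.functor.map (face P true h) ≫ g := by
    obtain ⟨f', hf'⟩ := exists_nonloop E.symm h hk e' e
    refine ⟨E.functor.map f' ≫ E.counit.app _, fun he => hf' ?_⟩
    simp only [← Category.assoc, ← E.functor.map_comp] at he
    exact E.functor.map_injective ((cancel_mono (E.counit.app (globe P k))).1 he)
  let ε (j : Dim n) (hj : j ≤ l) := (e j hj).some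
  let s (b : Bool) : globe P l ⟶ E.functor.obj (globe P k) :=
    (ε l le_rfl).inv ≫ E.functor.map (face P b h)
  have hs : Par (s false) (s true) := par_map E.functor ε (par_face h)
  have hsg : s false ≫ g ≠ s true ≫ g := fun he => hg (by
    simpa only [s, Category.assoc, cancel_epi] using he)
  have hfg : f ≫ g = 𝟙 _ := by
    apply endo_eq_id h hk
    -- The faces of the arrow `f` of `E(D_k)` come from parallel distinct `l`-arrows of `D_k`, that
    -- is, from its faces, and `g` separates the images of those.
    let a (b : Bool) := E.functor.preimage ((ε l le_rfl).hom ≫ face P b h ≫ f)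
    have ha (b : Bool) : face P b h ≫ f = (ε l le_rfl).inv ≫ E.functor.map (a b) := by simp [a]
    have hp : Par (a false) (a true) := by
      apply par_of_par_map E.functor ε
      rw [← ha, ← ha]
      exact (par_face h).comp f
    have hne : a false ≠ a true := fun he => hf (by rw [ha, ha, he])
    rw [← Category.assoc, ← Category.assoc, ha, ha]
    rcases hp.eq_face h hne with ⟨h0, h1⟩ | ⟨h0, h1⟩ <;> rw [h0, h1]
    · exact hsg
    · exact hsg.symm
  have hgf : g ≫ f = 𝟙 _ := by
    have key : E.functor.preimage (g ≫ f) = 𝟙 _ := by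
      apply endo_eq_id h hk
      intro he
      have he' := congrArg (fun φ => (ε l le_rfl).inv ≫ E.functor.map φ) he
      simp only [E.functor.map_comp, E.functor.map_preimage] at he'
      have he2 : (s false ≫ g) ≫ f = (s true ≫ g) ≫ f := by
        simpa only [s, Category.assoc] using he'
      rcases (hs.comp g).eq_face h hsg with ⟨h0, h1⟩ | ⟨h0, h1⟩ <;> rw [h0, h1] at he2
      · exact hf he2
      · exact hf he2.symm
    rw [← E.functor.map_preimage (g ≫ f), key, E.functor.map_id]
  exact ⟨⟨g, f, hgf, hfg⟩⟩

lemma globe_isTerminal {z : Dim n} (hz : z.1 = 0) :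
    Nonempty (Limits.IsTerminal (globe P z)) := by
  have hs : ∀ (m : Dim n) (c d : (disk.{u} z).Arr m), c = d := by
    intro m c d
    have hc := cell_valid c
    have hd := cell_valid d
    apply cell_injective
    ext <;> grind [Cell.Valid]
  refine ⟨Limits.IsTerminal.ofUniqueHom (fun C => ObjectProperty.homMk
    { app := fun m _ => ofCell ⟨0, false⟩ ⟨Nat.zero_le _, Nat.zero_le _, fun _ => rfl⟩
      map_src := fun _ _ => hs _ _ _
      map_tgt := fun _ _ => hs _ _ _
      map_idt := fun _ _ => hs _ _ _
      map_comp := fun _ _ _ _ _ => hs _ _ _ }) fun C f =>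
    ObjectProperty.hom_ext _ (hom_ext fun m x => hs m _ _)⟩

/-- Autoequivalences fix the globes. -/
theorem globe_iso (E : P.FullSubcategory ≌ P.FullSubcategory) (k : Dim n) :
    Nonempty (E.functor.obj (globe P k) ≅ globe P k) := by
  obtain ⟨d, hd⟩ := k
  induction d using Nat.strong_induction_on generalizing E with
  | _ d ih =>
    rcases d with _ | d
    · obtain ⟨t⟩ := globe_isTerminal (P := P) (z := ⟨0, hd⟩) rfl
      exact ⟨(Limits.IsTerminal.isTerminalObj E.functor _ t).uniqueUpToIso t⟩
    · have hl : (d : ℕ∞) ≤ n := (Nat.cast_le.2 d.le_succ).trans hd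
      have hlt : ∀ j : Dim n, j ≤ ⟨d, hl⟩ → j.1 < d + 1 := fun j hj => Nat.lt_succ_of_le hj
      exact globe_iso_step E (l := ⟨d, hl⟩) (Nat.lt_succ_self d) rfl
        (fun j hj => ih j.1 (hlt j hj) E j.2) (fun j hj => ih j.1 (hlt j hj) E.symm j.2)

end Equivalence

/-! ### A labelled composable pair and the sub-`n`-category it generates -/

lemma cell_idle {k i m : Dim n} (h : i ≤ m) (c : (disk.{u} k).Arr i) :
    cell ((disk k).idle h c) = cell c := by
  rcases h.eq_or_lt with rfl | h'
  · simp
  · rw [idle_of_lt _ h', cell_idt]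

lemma cell_bdle {k i m : Dim n} (b : Bool) (h : i ≤ m) (c : (disk.{u} k).Arr m) :
    cell ((disk k).bdle b h c) = (cell c).bd b i.1 := by
  rcases h.eq_or_lt with rfl | h'
  · rw [bdle_rfl, Cell.bd, if_pos (cell_valid c).1]
  · rw [bdle_of_lt _ _ h', cell_bd]

lemma cell_ofArr_app {k l m : Dim n} (z : (disk.{u} k).Arr l) (c : (disk.{u} l).Arr m) :
    cell ((ofArr z).app m c) = (cell z).bd (cell c).sgn (cell c).dim :=
  (cell_idle (cell_valid c).1 _).trans (cell_bdle _ (cell_valid c).2.1 z)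

lemma exists_eq_idt {k i m : Dim n} (h : i < m) (c : (disk.{u} k).Arr m)
    (hc : (cell c).dim ≤ i.1) : ∃ c', c = (disk k).idt h c' :=
  ⟨ofCell (cell c) ⟨hc, (cell_valid c).2⟩, rfl⟩

lemma composable_of_cell {k i m : Dim n} (h : i < m) {c d : (disk.{u} k).Arr m}
    (hcd : (cell c).bd false i.1 = (cell d).bd true i.1) : (disk k).src h c = (disk k).tgt h d :=
  cell_injective hcd

section Span

variable {E : StrictNCat.{u} n} {j k : Dim n} (X Y : disk.{u} k ⟶ E) (p q : E ⟶ disk.{u} k)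

/-- Membership in the sub-`n`-category generated by two `k`-arrows composable in dimension `j`. -/
def SpanMem (j : Dim n) (X Y : disk.{u} k ⟶ E) (m : Dim n) (w : E.Arr m) : Prop :=
  (∃ c, w = X.app m c) ∨ (∃ d, w = Y.app m d) ∨
    ∃ (h : j < m) (c d : (disk.{u} k).Arr m) (hcd : E.src h (X.app m c) = E.tgt h (Y.app m d)),
      j.1 < (cell c).dim ∧ j.1 < (cell d).dim ∧ w = E.comp h (X.app m c) (Y.app m d) hcd

/-- Labels that distinguish the arrows generated by two `k`-arrows composable in dimension `j`. -/
structure IsLabelled (j : Dim n) (X Y : disk.{u} k ⟶ E) (p q : E ⟶ disk.{u} k) : Prop where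
  -- `p` takes the arrow `X` to the top cell and `Y` to an identity on the `j`-source of the globe;
  -- `q` takes `Y` to the top cell and `X` to an identity on the `j`-target.
  pX {m : Dim n} (c : (disk.{u} k).Arr m) : cell (p.app m (X.app m c)) = cell c
  qX {m : Dim n} (c : (disk.{u} k).Arr m) :
    cell (q.app m (X.app m c)) = Cell.bd (cell c).sgn (cell c).dim ⟨j.1, true⟩
  pY {m : Dim n} (c : (disk.{u} k).Arr m) :
    cell (p.app m (Y.app m c)) = Cell.bd (cell c).sgn (cell c).dim ⟨j.1, false⟩
  qY {m : Dim n} (c : (disk.{u} k).Arr m) : cell (q.app m (Y.app m c)) = cell c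

variable {X Y p q}

lemma IsLabelled.p_comp (L : IsLabelled j X Y p q) {m : Dim n} (h : j < m)
    {c d : (disk.{u} k).Arr m} (hcd : E.src h (X.app m c) = E.tgt h (Y.app m d))
    (hc : j.1 < (cell c).dim) :
    cell (p.app m (E.comp h (X.app m c) (Y.app m d) hcd)) = cell c := by
  rw [p.map_comp _ _ _ _ (map_composable p hcd), cell_comp, L.pX, if_neg (not_le.2 hc)]

lemma IsLabelled.q_comp (L : IsLabelled j X Y p q) {m : Dim n} (h : j < m)
    {c d : (disk.{u} k).Arr m} (hcd : E.src h (X.app m c) = E.tgt h (Y.app m d))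
    (hc : j.1 < (cell c).dim) :
    cell (q.app m (E.comp h (X.app m c) (Y.app m d) hcd)) = cell d := by
  rw [q.map_comp _ _ _ _ (map_composable q hcd), cell_comp, L.qX, L.qY, if_pos]
  grind [Cell.bd]

lemma label_composable (p : E ⟶ disk.{u} k) {i m : Dim n} {h : i < m} {w w' : E.Arr m}
    (hw : E.src h w = E.tgt h w') :
    (cell (p.app m w)).bd false i.1 = (cell (p.app m w')).bd true i.1 :=
  congrArg cell (map_composable p hw)

/-- Composability in `E` implies composability of the labels, which excludes all pairs but three
kinds: one factor is the identity of an `i`-arrow; `i = j` with `X` on the left and `Y` on the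
right; or two composites with `j < i`, which the interchange law merges into one. -/
lemma IsLabelled.comp_mem (L : IsLabelled j X Y p q) {i m : Dim n} (h : i < m) (w w' : E.Arr m)
    (hw : E.src h w = E.tgt h w') (hm : SpanMem j X Y m w) (hm' : SpanMem j X Y m w') :
    SpanMem j X Y m (E.comp h w w' hw) := by
  have hp := label_composable p hw
  have hq := label_composable q hw
  have degX {Z : disk.{u} k ⟶ E} {c : (disk.{u} k).Arr m} (hc : (cell c).dim ≤ i.1) :
      ∃ a, Z.app m c = E.idt h a := by
    obtain ⟨c', rfl⟩ := exists_eq_idt h c hc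
    exact ⟨_, Z.map_idt h c'⟩
  have left (ha : ∃ a, w = E.idt h a) : SpanMem j X Y m (E.comp h w w' hw) := by
    obtain ⟨a, ha⟩ := ha
    rwa [E.comp_of_left_eq_idt h hw ha]
  have right (ha : ∃ a, w' = E.idt h a) : SpanMem j X Y m (E.comp h w w' hw) := by
    obtain ⟨a, ha⟩ := ha
    rwa [E.comp_of_right_eq_idt h hw ha]
  rcases hm with ⟨c, rfl⟩ | ⟨c, rfl⟩ | ⟨hj, c, d, hcd, hc, hd, rfl⟩
  · by_cases hci : (cell c).dim ≤ i.1
    · exact left (degX hci)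
    rw [L.pX] at hp
    rw [L.qX] at hq
    rcases hm' with ⟨c', rfl⟩ | ⟨c', rfl⟩ | ⟨hj, c', d', hcd', hc', hd', rfl⟩
    · by_cases hci' : (cell c').dim ≤ i.1
      · exact right (degX hci')
      rw [L.pX] at hp
      grind [Cell.bd]
    · by_cases hci' : (cell c').dim ≤ i.1
      · exact right (degX hci')
      rw [L.pY] at hp
      rw [L.qY] at hq
      have hij : i.1 = j.1 := by grind [Cell.bd]
      obtain rfl : i = j := Subtype.ext hij
      exact Or.inr (Or.inr ⟨h, c, c', hw, not_le.1 hci, not_le.1 hci', rfl⟩)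
    · rw [L.p_comp _ _ hc'] at hp
      rw [L.q_comp _ _ hc'] at hq
      grind [Cell.bd]
  · by_cases hci : (cell c).dim ≤ i.1
    · exact left (degX hci)
    rw [L.pY] at hp
    rw [L.qY] at hq
    rcases hm' with ⟨c', rfl⟩ | ⟨c', rfl⟩ | ⟨hj, c', d', hcd', hc', hd', rfl⟩
    · by_cases hci' : (cell c').dim ≤ i.1
      · exact right (degX hci')
      rw [L.pX] at hp
      rw [L.qX] at hq
      grind [Cell.bd]
    · by_cases hci' : (cell c').dim ≤ i.1
      · exact right (degX hci')
      rw [L.qY] at hq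
      grind [Cell.bd]
    · rw [L.p_comp _ _ hc'] at hp
      rw [L.q_comp _ _ hc'] at hq
      grind [Cell.bd]
  · rw [L.p_comp _ _ hc] at hp
    rw [L.q_comp _ _ hc] at hq
    rcases hm' with ⟨c', rfl⟩ | ⟨c', rfl⟩ | ⟨hj, c', d', hcd', hc', hd', rfl⟩
    · by_cases hci' : (cell c').dim ≤ i.1
      · exact right (degX hci')
      rw [L.pX] at hp
      rw [L.qX] at hq
      grind [Cell.bd]
    · by_cases hci' : (cell c').dim ≤ i.1
      · exact right (degX hci')
      rw [L.pY] at hp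
      rw [L.qY] at hq
      grind [Cell.bd]
    · rw [L.p_comp _ _ hc'] at hp
      rw [L.q_comp _ _ hc'] at hq
      have hji : j.1 < i.1 := by grind [Cell.bd]
      have hji' : j < i := hji
      have hcc := composable_of_cell h hp
      have hdd := composable_of_cell h hq
      have hcX := map_composable X hcc
      have hdY := map_composable Y hdd
      have h2 : E.src hj (E.comp h (X.app m c) (X.app m c') hcX) =
          E.tgt hj (E.comp h (Y.app m d) (Y.app m d') hdY) := by
        rw [← bd_false, ← bd_true, E.bd_comp_of_gt_right false hji' h,
          E.bd_comp_of_gt_right true hji' h]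
        exact hcd'
      refine Or.inr (Or.inr ⟨hj, (disk k).comp h c c' hcc, (disk k).comp h d d' hdd, ?_, ?_, ?_, ?_⟩)
      · rw [X.map_comp _ _ _ _ hcX, Y.map_comp _ _ _ _ hdY]
        exact h2
      · rw [cell_comp]; split_ifs <;> assumption
      · rw [cell_comp]; split_ifs <;> assumption
      · rw [E.comp_congr hj (X.map_comp _ _ _ _ hcX) (Y.map_comp _ _ _ _ hdY)]
        exact (E.interchange hji' h _ _ _ _ hcX hdY hcd hcd' h2 hw).symm

/-- The sub-`n`-category generated by two `k`-arrows composable in dimension `j`. -/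
def IsLabelled.span (L : IsLabelled j X Y p q) : Sub E where
  mem := SpanMem j X Y
  bd_mem b {i m} h w hw := by
    rcases hw with ⟨c, rfl⟩ | ⟨c, rfl⟩ | ⟨hj, c, d, hcd, hc, hd, rfl⟩
    · exact Or.inl ⟨_, (map_bd X b h c).symm⟩
    · exact Or.inr (Or.inl ⟨_, (map_bd Y b h c).symm⟩)
    · rcases lt_trichotomy i j with hij | rfl | hij
      · rw [E.bd_comp_of_gt_left b hij hj]
        exact Or.inl ⟨_, (map_bd X b h c).symm⟩
      · cases b
        · exact Or.inr (Or.inl ⟨_, (E.src_comp _ _ _ _).trans (Y.map_src h d).symm⟩)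
        · exact Or.inl ⟨_, (E.tgt_comp _ _ _ _).trans (X.map_tgt h c).symm⟩
      · have hs : E.src hij (E.bd b h (X.app m c)) = E.tgt hij (E.bd b h (Y.app m d)) := by
          rw [E.src_bd, E.tgt_bd, hcd]
        have hij' : j.1 < i.1 := hij
        refine Or.inr (Or.inr ⟨hij, (disk k).bd b h c, (disk k).bd b h d, ?_, ?_, ?_, ?_⟩)
        · rw [map_bd, map_bd, hs]
        · rw [cell_bd, Cell.bd]; split_ifs <;> assumption
        · rw [cell_bd, Cell.bd]; split_ifs <;> assumption
        · rw [E.bd_comp_of_lt b hij h _ _ hcd hs]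
          exact E.comp_congr hij (map_bd X b h c).symm (map_bd Y b h d).symm hs
  idt_mem {i m} h w hw := by
    rcases hw with ⟨c, rfl⟩ | ⟨c, rfl⟩ | ⟨hj, c, d, hcd, hc, hd, rfl⟩
    · exact Or.inl ⟨_, (X.map_idt h c).symm⟩
    · exact Or.inr (Or.inl ⟨_, (Y.map_idt h c).symm⟩)
    · have hs : E.src (hj.trans h) (E.idt h (X.app i c)) =
          E.tgt (hj.trans h) (E.idt h (Y.app i d)) := by
        rw [← bd_false, ← bd_true, E.bd_idt_of_lt false hj h, E.bd_idt_of_lt true hj h]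
        exact hcd
      refine Or.inr (Or.inr ⟨hj.trans h, (disk k).idt h c, (disk k).idt h d, ?_, hc, hd, ?_⟩)
      · rw [X.map_idt, Y.map_idt, hs]
      · rw [E.idt_comp_idt hj h _ _ hcd hs]
        exact E.comp_congr _ (X.map_idt h c).symm (Y.map_idt h d).symm hs
  comp_mem h x y hxy hx hy := L.comp_mem h x y hxy hx hy

/-- Only the composite has nondegenerate labels. -/
lemma IsLabelled.eq_comp (L : IsLabelled j X Y p q) (h : j < k) {w : E.Arr k}
    (hw : SpanMem j X Y k w) (hp : p.app k w = top k) (hq : q.app k w = top k)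
    (hXY : E.src h (X.app k (top k)) = E.tgt h (Y.app k (top k))) :
    w = E.comp h (X.app k (top k)) (Y.app k (top k)) hXY := by
  have h' : j.1 < k.1 := h
  have hp' := congrArg cell hp
  have hq' := congrArg cell hq
  rw [cell_top] at hp' hq'
  rcases hw with ⟨c, rfl⟩ | ⟨c, rfl⟩ | ⟨hj, c, d, hcd, hc, hd, rfl⟩
  · rw [L.qX] at hq'
    rw [L.pX] at hp'
    grind [Cell.bd]
  · rw [L.pY] at hp'
    rw [L.qY] at hq'
    grind [Cell.bd]
  · rw [L.p_comp _ _ hc] at hp'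
    rw [L.q_comp _ _ hc] at hq'
    obtain rfl : c = top k := cell_injective hp'
    obtain rfl : d = top k := cell_injective hq'
    rfl

/-- Labels for two arrows of an arbitrary `n`-category, in its product with two globes. -/
lemma isLabelled_prod {C : StrictNCat.{u} n} (h : j < k) (x y : C.Arr k) :
    IsLabelled j
      (ofArr (C := C.prod ((disk k).prod (disk k)))
        (x, top k, (disk k).idt h ((disk k).tgt h (top k))))
      (ofArr (C := C.prod ((disk k).prod (disk k)))
        (y, (disk k).idt h ((disk k).src h (top k)), top k))
      (prodSnd _ _ ≫ prodFst _ _) (prodSnd _ _ ≫ prodSnd _ _) := by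
  have hjk : j.1 < k.1 := h
  -- A functor to a globe commutes with taking iterated boundaries and identities, so the label of
  -- `z` determines the labels of everything derived from `z`.
  have key : ∀ (z : (C.prod ((disk.{u} k).prod (disk.{u} k))).Arr k)
      (r : C.prod ((disk.{u} k).prod (disk.{u} k)) ⟶ disk.{u} k) {m : Dim n}
      (c : (disk.{u} k).Arr m),
      cell (r.app m ((ofArr z).app m c)) =
        (cell (r.app k z)).bd (cell c).sgn (cell c).dim := by
    intro z r m c
    rw [← cell_ofArr_app]
    congr 1
    exact app_evalCell r z _ (cell_valid c)
  have htop {m : Dim n} (c : (disk.{u} k).Arr m) :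
      Cell.bd (cell c).sgn (cell c).dim ⟨k.1, false⟩ = cell c := by
    have := cell_valid c
    ext <;> grind [Cell.Valid, Cell.bd]
  have hbd (b : Bool) : Cell.bd.{u} b j.1 ⟨k.1, false⟩ = ⟨j.1, b⟩ := if_neg (not_le.2 hjk)
  constructor
  · intro m c
    exact (key _ _ c).trans (htop c)
  · intro m c
    refine (key _ _ c).trans ?_
    exact congrArg (Cell.bd _ _) (hbd true)
  · intro m c
    refine (key _ _ c).trans ?_
    exact congrArg (Cell.bd _ _) (hbd false)
  · intro m c
    exact (key _ _ c).trans (htop c)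

end Span

/-! ### Sources and targets determine identities and composites -/

section Rigidity

variable {P : ObjectProperty (StrictNCat.{u} n)}
  {G : P.FullSubcategory ⥤ P.FullSubcategory}

/-- A natural family of bijections on arrows that is compatible with sources and targets. -/
structure GlobularIso (G : P.FullSubcategory ⥤ P.FullSubcategory) where
  app (k : Dim n) (C : P.FullSubcategory) : C.obj.Arr k → (G.obj C).obj.Arr k
  naturality {k : Dim n} {C D : P.FullSubcategory} (f : C ⟶ D) (x : C.obj.Arr k) :
    (G.map f).hom.app k (app k C x) = app k D (f.hom.app k x)
  bijective (k : Dim n) (C : P.FullSubcategory) : Function.Bijective (app k C)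
  map_bd (b : Bool) {j k : Dim n} (h : j < k) {C : P.FullSubcategory} (x : C.obj.Arr k) :
    app j C (C.obj.bd b h x) = (G.obj C).obj.bd b h (app k C x)

variable (β : GlobularIso G)

lemma GlobularIso.map_composable {j k : Dim n} {h : j < k} {C : P.FullSubcategory}
    {x y : C.obj.Arr k} (hxy : C.obj.src h x = C.obj.tgt h y) :
    (G.obj C).obj.src h (β.app k C x) = (G.obj C).obj.tgt h (β.app k C y) := by
  have h1 := β.map_bd false h x
  have h2 := β.map_bd true h y
  rw [bd_false, bd_false] at h1
  rw [bd_true, bd_true] at h2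
  rw [← h1, ← h2, hxy]

variable [Admissible P]

/-- By naturality it suffices to treat the top arrow of `D_j`. Every `k`-arrow of `D_j` is the
identity of its `j`-source, so the preimage of the identity is recognised by its source alone. -/
lemma GlobularIso.map_idt {j k : Dim n} (h : j < k) {C : P.FullSubcategory} (x : C.obj.Arr j) :
    β.app k C (C.obj.idt h x) = (G.obj C).obj.idt h (β.app j C x) := by
  have htop : β.app k (globe P j) ((disk j).idt h (top j)) =
      (G.obj (globe P j)).obj.idt h (β.app j (globe P j) (top j)) := by
    obtain ⟨w, hw⟩ := (β.bijective k (globe P j)).2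
      ((G.obj (globe P j)).obj.idt h (β.app j (globe P j) (top j)))
    have h1 : (disk j).bd false h w = top j := by
      apply (β.bijective j (globe P j)).1
      rw [β.map_bd (C := globe P j), hw, bd_idt]
    have hwv := cell_valid w
    have h2 := congrArg cell h1
    rw [cell_bd, Cell.bd, if_pos hwv.2.1] at h2
    rw [← hw]
    exact congrArg _ (cell_injective h2.symm)
  have hx : (pt x).hom.app k ((disk j).idt h (top j)) = C.obj.idt h x := by
    refine ((ofArr x).map_idt h (top j)).trans ?_
    rw [ofArr_top]
  rw [← hx, ← β.naturality, htop, (G.map (pt x)).hom.map_idt, β.naturality]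
  exact congrArg _ (congrArg _ (ofArr_top x))

/-- Lift `x` and `y` to a labelled composable pair in `C × D_k × D_k` and let `Q` be the
sub-`n`-category it generates. The arrow `w` of `Q` that corresponds to the composite formed in `G
Q` has both labels equal to the top arrow, and the only such arrow of `Q` is the composite.
Projection to `C` gives the claim. -/
lemma GlobularIso.map_comp {j k : Dim n} (h : j < k) {C : P.FullSubcategory}
    (x y : C.obj.Arr k) (hxy : C.obj.src h x = C.obj.tgt h y)
    (hxy' : (G.obj C).obj.src h (β.app k C x) = (G.obj C).obj.tgt h (β.app k C y)) :
    β.app k C (C.obj.comp h x y hxy) = (G.obj C).obj.comp h (β.app k C x) (β.app k C y) hxy' := by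
  have L := isLabelled_prod h x y
  let E : P.FullSubcategory := ⟨C.obj.prod ((disk k).prod (disk k)),
    Admissible.prod C.2 (Admissible.prod (Admissible.disk k) (Admissible.disk k))⟩
  let Q : P.FullSubcategory := ⟨L.span.toCat, Admissible.sub _ E.2⟩
  let i : Q ⟶ E := ObjectProperty.homMk L.span.incl
  let r : E ⟶ C := ObjectProperty.homMk (prodFst _ _)
  let p : E ⟶ globe P k := ObjectProperty.homMk (prodSnd _ _ ≫ prodFst _ _)
  let q : E ⟶ globe P k := ObjectProperty.homMk (prodSnd _ _ ≫ prodSnd _ _)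
  let s := (disk.{u} k).src h (top k)
  let t := (disk.{u} k).tgt h (top k)
  let x₁ : E.obj.Arr k := (x, top k, (disk k).idt h t)
  let y₁ : E.obj.Arr k := (y, (disk k).idt h s, top k)
  have hx₁ : (ofArr x₁).app k (top k) = x₁ := ofArr_top x₁
  have hy₁ : (ofArr y₁).app k (top k) = y₁ := ofArr_top y₁
  let x₂ : Q.obj.Arr k := (⟨x₁, Or.inl ⟨top k, hx₁.symm⟩⟩ : {w : E.obj.Arr k // L.span.mem k w})
  let y₂ : Q.obj.Arr k :=
    (⟨y₁, Or.inr (Or.inl ⟨top k, hy₁.symm⟩)⟩ : {w : E.obj.Arr k // L.span.mem k w})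
  have h₁ : E.obj.src h x₁ = E.obj.tgt h y₁ := by
    refine Prod.ext hxy (Prod.ext ?_ ?_)
    · exact ((disk k).tgt_idt h s).symm
    · exact (disk k).src_idt h t
  have h₂ : Q.obj.src h x₂ = Q.obj.tgt h y₂ := Subtype.ext h₁
  have h₃ := β.map_composable h₂
  obtain ⟨w, hw⟩ := (β.bijective k Q).2 ((G.obj Q).obj.comp h _ _ h₃)
  have key {D : P.FullSubcategory} (f : E ⟶ D)
      (hf : (G.obj D).obj.src h (β.app k D (f.hom.app k x₁)) =
        (G.obj D).obj.tgt h (β.app k D (f.hom.app k y₁))) :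
      β.app k D (f.hom.app k (i.hom.app k w)) =
        (G.obj D).obj.comp h (β.app k D (f.hom.app k x₁)) (β.app k D (f.hom.app k y₁)) hf := by
    have h1 := β.naturality (i ≫ f) w
    refine h1.symm.trans ?_
    rw [hw, (G.map (i ≫ f)).hom.map_comp _ _ _ _ (StrictNCat.map_composable _ h₃)]
    exact comp_congr _ h (β.naturality (i ≫ f) x₂) (β.naturality (i ≫ f) y₂) _
  -- Under `p` the pair becomes the top arrow and an identity, so the unit law and
  -- `GlobularIso.map_idt` compute the composite; no compatibility with general composites is
  -- presupposed.
  have hp : p.hom.app k (i.hom.app k w) = top k := by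
    apply (β.bijective k (globe P k)).1
    have h1 : (disk.{u} k).src h (top k) = (disk k).tgt h ((disk k).idt h s) :=
      ((disk k).tgt_idt h s).symm
    exact (key p (β.map_composable (C := globe P k) h1)).trans
      (comp_of_right_eq_idt _ h _ (β.map_idt (C := globe P k) h s))
  have hq : q.hom.app k (i.hom.app k w) = top k := by
    apply (β.bijective k (globe P k)).1
    have h1 : (disk.{u} k).src h ((disk k).idt h t) = (disk k).tgt h (top k) :=
      (disk k).src_idt h t
    exact (key q (β.map_composable (C := globe P k) h1)).trans
      (comp_of_left_eq_idt _ h _ (β.map_idt (C := globe P k) h t))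
  have hXY : E.obj.src h ((ofArr x₁).app k (top k)) = E.obj.tgt h ((ofArr y₁).app k (top k)) := by
    rw [hx₁, hy₁, h₁]
  have hmem : SpanMem j (ofArr x₁) (ofArr y₁) k (i.hom.app k w) := Subtype.prop w
  have hwc := (L.eq_comp h hmem hp hq hXY).trans (E.obj.comp_congr h hx₁ hy₁ hXY)
  have hr : r.hom.app k (i.hom.app k w) = C.obj.comp h x y hxy :=
    congrArg (r.hom.app k) hwc
  rw [← hr]
  exact key r hxy'

/-- A functor that has the same arrows as the identity functor, naturally and compatibly with
sources and targets, is isomorphic to the identity functor. -/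
theorem GlobularIso.nonempty_iso (β : GlobularIso G) : Nonempty (𝟭 P.FullSubcategory ≅ G) := by
  let f (C : P.FullSubcategory) : C ⟶ G.obj C := ObjectProperty.homMk
    { app := fun k => β.app k C
      map_src := fun h x => β.map_bd false h x
      map_tgt := fun h x => β.map_bd true h x
      map_idt := fun h x => β.map_idt h x
      map_comp := fun h x y hxy hxy' => β.map_comp h x y hxy hxy' }
  have (C : P.FullSubcategory) : IsIso (f C) := by
    rw [← ObjectProperty.isIso_hom_iff]
    exact isIso_of_bijective _ fun k => β.bijective k C
  exact ⟨NatIso.ofComponents (fun C => @asIso _ _ _ _ (f C) (this C)) fun {C D} g =>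
    ObjectProperty.hom_ext _ (hom_ext fun k x => (β.naturality g x).symm)⟩

end Rigidity

/-! ### Natural transformations between the functors `op_δ` -/

section Op

open Classical in
lemma op_bd (δ : Signs n) (C : StrictNCat.{u} n) (b : Bool) {j k : Dim n} (h : j < k)
    (x : C.Arr k) : (C.op δ).bd b h x = C.bd (if Reverses δ j then !b else b) h x := by
  by_cases hj : Reverses δ j <;> cases b <;> simp [op, bd, hj]

/-- The functor `op_δ` on an admissible class of strict `n`-categories. -/
noncomputable def classOp (P : ObjectProperty (StrictNCat.{u} n)) [Admissible P] (δ : Signs n) :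
    P.FullSubcategory ⥤ P.FullSubcategory :=
  P.lift (P.ι ⋙ opFunctor δ) fun C => Admissible.op δ C.2

variable {P : ObjectProperty (StrictNCat.{u} n)} [Admissible P]

/-- `op_δ` is an involution. -/
noncomputable def classOpCompSelf (δ : Signs n) : classOp P δ ⋙ classOp P δ ≅ 𝟭 _ :=
  NatIso.ofComponents (fun C => P.isoMk (opOpIso δ C.obj)) (fun _ => rfl)

lemma reverses_iff {δ : Signs n} {j : Dim n} (h : 1 ≤ j.1 + 1 ∧ ((j.1 + 1 : ℕ) : ℕ∞) ≤ n) :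
    Reverses δ j ↔ δ ⟨j.1 + 1, h⟩ = 1 := ⟨fun ⟨_, h⟩ => h, fun h' => ⟨h, h'⟩⟩

lemma signs_ext {δ δ' : Signs n}
    (h : ∀ l k : Dim n, k.1 = l.1 + 1 → (Reverses δ l ↔ Reverses δ' l)) : δ = δ' := by
  funext ⟨i, hi, hin⟩
  obtain ⟨l, rfl⟩ : ∃ l, i = l + 1 := ⟨i - 1, by omega⟩
  have hl : (l : ℕ∞) ≤ n := (Nat.cast_le.2 l.le_succ).trans hin
  have h1 := h ⟨l, hl⟩ ⟨l + 1, hin⟩ rfl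
  rw [reverses_iff ⟨hi, hin⟩, reverses_iff ⟨hi, hin⟩] at h1
  generalize δ ⟨l + 1, hi, hin⟩ = a at h1
  generalize δ' ⟨l + 1, hi, hin⟩ = b at h1
  revert a b
  decide

section NatTrans

variable {δ δ' : Signs n} (α : classOp P δ ⟶ classOp P δ')

/-- The Yoneda argument: every `k`-arrow is the image of the top arrow of `D_k`, and the functors
`op_δ` do not change underlying maps. -/
lemma app_eq_of_app_top {k : Dim n} (h : (α.app (globe P k)).hom.app k (top k) = top k)
    (C : P.FullSubcategory) (x : C.obj.Arr k) : (α.app C).hom.app k x = x := by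
  have h1 : ((classOp P δ).map (pt x) ≫ α.app C).hom.app k (top k) =
      (α.app (globe P k) ≫ (classOp P δ').map (pt x)).hom.app k (top k) := by
    rw [α.naturality]
  have h2 : (α.app C).hom.app k ((ofArr x).app k (top k)) =
      (ofArr x).app k ((α.app (globe P k)).hom.app k (top k)) := h1
  rw [h] at h2
  rwa [ofArr_top] at h2

lemma bd_top_injective {l k : Dim n} (h : l < k) {b b' : Bool}
    (hb : (disk.{u} k).bd b h (top k) = (disk k).bd b' h (top k)) : b = b' := by
  have h' : ¬ k.1 ≤ l.1 := not_le.2 (show l.1 < k.1 from h)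
  have := congrArg (fun c => (cell c).sgn) hb
  simpa [cell_bd, Cell.bd, h'] using this

-- `α` fixes `l`-arrows, so it takes the top arrow of `D_k` to an arrow with the same pair of
-- distinct `l`-boundaries, up to the reversals by `δ` and `δ'`. Such an arrow is not a loop, hence
-- is the top arrow, and then the two reversals must agree.
open Classical in
lemma app_top_succ {l k : Dim n} (h : l < k) (hk : k.1 = l.1 + 1)
    (hl : (α.app (globe P l)).hom.app l (top l) = top l) :
    (α.app (globe P k)).hom.app k (top k) = top k ∧ (Reverses δ l ↔ Reverses δ' l) := by
  have key (b : Bool) : (disk.{u} k).bd (if Reverses δ l then !b else b) h (top k) =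
      (disk k).bd (if Reverses δ' l then !b else b) h
        ((α.app (globe P k)).hom.app k (top k)) := by
    have h1 := map_bd (α.app (globe P k)).hom b h (top k)
    refine Eq.trans ?_ (h1.trans (op_bd δ' _ b h _))
    refine Eq.trans ?_ (app_eq_of_app_top α hl (globe P k) _).symm
    exact (op_bd δ (disk k) b h (top k)).symm
  have htop : (α.app (globe P k)).hom.app k (top k) = top k := by
    apply eq_top_of_bd_ne h hk
    intro he
    have he' : ∀ b b', (disk.{u} k).bd b h ((α.app (globe P k)).hom.app k (top k)) =
        (disk k).bd b' h ((α.app (globe P k)).hom.app k (top k)) := by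
      intro b b'
      cases b <;> cases b' <;> first | rfl | exact he | exact he.symm
    have := bd_top_injective h ((key false).trans ((he' _ _).trans (key true).symm))
    split_ifs at this
    all_goals simp at this
  refine ⟨htop, ?_⟩
  have := key false
  rw [htop] at this
  have := bd_top_injective h this
  by_cases h1 : Reverses δ l <;> by_cases h2 : Reverses δ' l <;> simp [h1, h2] at this ⊢

lemma app_top (k : Dim n) : (α.app (globe P k)).hom.app k (top k) = top k := by
  obtain ⟨d, hd⟩ := k
  induction d with
  | zero => exact eq_top (Nat.zero_le _)
  | succ d ih =>
    have hl : (d : ℕ∞) ≤ n := (Nat.cast_le.2 d.le_succ).trans hd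
    exact (app_top_succ α (l := ⟨d, hl⟩) (Nat.lt_succ_self d) rfl (ih hl)).1

/-- A natural transformation between the functors `op_δ` is the identity on arrows. -/
lemma natTrans_app (C : P.FullSubcategory) (k : Dim n) (x : C.obj.Arr k) :
    (α.app C).hom.app k x = x := app_eq_of_app_top α (app_top α k) C x

lemma eq_of_natTrans (α : classOp P δ ⟶ classOp P δ') : δ = δ' := signs_ext fun l k hk =>
  (app_top_succ α (show l.1 < k.1 by omega) hk (app_top α l)).2

lemma natTrans_unique (α' : classOp P δ ⟶ classOp P δ') : α = α' := by
  refine NatTrans.ext (funext fun C => ObjectProperty.hom_ext _ (hom_ext fun k x => ?_))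
  exact (natTrans_app α C k x).trans (natTrans_app α' C k x).symm

end NatTrans

end Op

/-! ### The sign vector of an autoequivalence -/

section Signs

variable {P : ObjectProperty (StrictNCat.{u} n)} [Admissible P]
  (F : P.FullSubcategory ⥤ P.FullSubcategory) (e : ∀ k, F.obj (globe P k) ≅ globe P k)

/-- The map on `k`-arrows induced by a functor that fixes the `k`-globe. -/
def arrMap (k : Dim n) (C : P.FullSubcategory) (x : C.obj.Arr k) : (F.obj C).obj.Arr k :=
  arr ((e k).inv ≫ F.map (pt x))

/-- The faces of `D_k`, moved along the isomorphisms `e` and back through `F`, are still distinct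
and parallel, so they are the faces in the same or the opposite order. This is decided on the globe
alone and so is the same for all `C` and `x`. -/
lemma exists_flip [F.Full] [F.Faithful] {l k : Dim n} (h : l < k) :
    ∃ s : Bool, ∀ (b : Bool) (C : P.FullSubcategory) (x : C.obj.Arr k),
      (F.obj C).obj.bd b h (arrMap F e k C x) = arrMap F e l C (C.obj.bd (b ^^ s) h x) := by
  let a (b : Bool) := F.preimage ((e l).hom ≫ face P b h ≫ (e k).inv)
  have ha (b : Bool) : face P b h ≫ (e k).inv = (e l).inv ≫ F.map (a b) := by simp [a]
  have hp : Par (a false) (a true) := by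
    apply par_of_par_map F (fun j _ => e j)
    rw [← ha, ← ha]
    exact (par_face h).comp _
  have hne : a false ≠ a true := fun he => face_ne (P := P) h (by
    rw [← cancel_mono (e k).inv, ha, ha, he])
  have key (b b' : Bool) (hb : a b = face P b' h) (C : P.FullSubcategory) (x : C.obj.Arr k) :
      (F.obj C).obj.bd b h (arrMap F e k C x) = arrMap F e l C (C.obj.bd b' h x) := by
    rw [arrMap, arrMap, ← arr_face_comp, reassoc_of% (ha b), ← F.map_comp, hb, face_pt]
  rcases hp.eq_face h hne with ⟨h0, h1⟩ | ⟨h0, h1⟩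
  · refine ⟨false, fun b C x => ?_⟩
    cases b
    · exact key _ _ h0 C x
    · exact key _ _ h1 C x
  · refine ⟨true, fun b C x => ?_⟩
    cases b
    · exact key _ _ h0 C x
    · exact key _ _ h1 C x

-- The `l`-boundary of a `k`-arrow is the `l`-boundary of its `(l+1)`-boundary, so only the flips
-- for the pairs `(l, l+1)` matter; `δ_i` records the flip for `(i-1, i)`.
open Classical in
lemma exists_signs [F.Full] [F.Faithful] :
    ∃ δ : Signs n, ∀ (b : Bool) {l k : Dim n} (h : l < k) (C : P.FullSubcategory)
      (x : C.obj.Arr k), (F.obj C).obj.bd b h (arrMap F e k C x) =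
        arrMap F e l C (C.obj.bd (if Reverses δ l then !b else b) h x) := by
  choose s hs using fun (l k : Dim n) (h : l < k) => exists_flip F e h
  let δ : Signs n := fun i =>
    if s ⟨i.1 - 1, (Nat.cast_le.2 (Nat.sub_le _ _)).trans i.2.2⟩ ⟨i.1, i.2.2⟩
      (Nat.sub_lt i.2.1 one_pos) then 1 else 0
  have hδ (l : Dim n) (hl : ((l.1 + 1 : ℕ) : ℕ∞) ≤ n) (b : Bool) :
      (b ^^ s l ⟨l.1 + 1, hl⟩ (Nat.lt_succ_self l.1)) = if Reverses δ l then !b else b := by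
    have h2 : δ ⟨l.1 + 1, Nat.succ_pos _, hl⟩ =
      if s l ⟨l.1 + 1, hl⟩ (Nat.lt_succ_self l.1) then 1 else 0 := rfl
    rw [reverses_iff ⟨Nat.succ_pos _, hl⟩, h2]
    cases s l ⟨l.1 + 1, hl⟩ (Nat.lt_succ_self l.1) <;> simp
  refine ⟨δ, fun b l k h C x => ?_⟩
  have hl : ((l.1 + 1 : ℕ) : ℕ∞) ≤ n := (Nat.cast_le.2 (show l.1 < k.1 from h)).trans k.2
  have h1 : l < ⟨l.1 + 1, hl⟩ := Nat.lt_succ_self l.1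
  have h2 : (⟨l.1 + 1, hl⟩ : Dim n) ≤ k := show l.1 < k.1 from h
  rw [← hδ l hl]
  rcases h2.eq_or_lt with rfl | h2
  · exact hs _ _ _ _ _ _
  · rw [← bd_bd _ b false h1 h2, hs _ _ h2, hs _ _ h1, bd_bd]

lemma arrMap_bijective [F.Full] [F.Faithful] (k : Dim n) (C : P.FullSubcategory) :
    Function.Bijective (arrMap F e k C) := by
  constructor
  · intro x y hxy
    have h1 := arr_injective hxy
    rw [cancel_epi] at h1
    rw [← arr_pt x, F.map_injective h1, arr_pt]
  · intro y
    refine ⟨arr (F.preimage ((e k).hom ≫ pt y)), ?_⟩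
    simp [arrMap]

/-- Every autoequivalence of an admissible class is isomorphic to some `op_δ`. -/
theorem exists_iso_classOp (E : P.FullSubcategory ≌ P.FullSubcategory) :
    ∃ δ : Signs n, Nonempty (classOp P δ ≅ E.functor) := by
  let e (k : Dim n) := (globe_iso E k).some
  obtain ⟨δ, hδ⟩ := exists_signs E.functor e
  -- Composition with `op_δ` undoes the flips, so the bijection on arrows becomes compatible with
  -- sources and targets. As `op_δ` is an involution, an isomorphism of the composite with the
  -- identity makes `E.functor` isomorphic to `op_δ`.
  let β : GlobularIso (E.functor ⋙ classOp P δ) :=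
    { app := fun k C => arrMap E.functor e k C
      naturality := fun {k C D} f x => by
        change (E.functor.map f).hom.app k (arrMap E.functor e k C x) = _
        rw [arrMap, ← arr_comp, Category.assoc, ← E.functor.map_comp, pt_comp]
        rfl
      bijective := arrMap_bijective E.functor e
      map_bd := fun b {j k} h {C} x => by
        classical
        refine Eq.trans ?_ (op_bd δ (E.functor.obj C).obj b h _).symm
        rw [hδ]
        by_cases hj : Reverses δ j <;> simp only [hj, if_true, if_false, Bool.not_not] <;> rfl }
  obtain ⟨i⟩ := β.nonempty_iso
  exact ⟨δ, ⟨(Functor.leftUnitor _).symm ≪≫ Functor.isoWhiskerRight i (classOp P δ) ≪≫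
    Functor.associator _ _ _ ≪≫ Functor.isoWhiskerLeft _ (classOpCompSelf δ) ≪≫
    Functor.rightUnitor _⟩⟩

end Signs

/-! ### The two admissible classes -/

section Classes

instance : Admissible (⊤ : ObjectProperty (StrictNCat.{u} n)) where
  disk _ := trivial
  sub _ _ := trivial
  prod _ _ := trivial
  op _ _ _ := trivial

/-- In a globe, a composite whose left factor `x` is nondegenerate above `j` equals `x` and so
cannot be an identity of a `j`-arrow. In a sub-`n`-category the arrow of which `x` is the identity
is the source of `x`, hence belongs to it. -/
instance : Admissible (IsRigid.{u} n) where
  disk d := by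
    intro j k h hk x y hxy hyx h₁ h₂
    have h1 := congrArg cell h₁
    have h2 := congrArg cell hxy
    have h3 := congrArg cell hyx
    rw [cell_comp, cell_idt, cell_tgt] at h1
    rw [cell_src, cell_tgt] at h2 h3
    refine exists_eq_idt h x ?_
    grind [Cell.bd]
  sub S hC := by
    intro j k h hk x y hxy hyx h₁ h₂
    obtain ⟨a, ha⟩ := hC h hk x.1 y.1 (congrArg Subtype.val hxy) (congrArg Subtype.val hyx)
      (congrArg Subtype.val h₁) (congrArg Subtype.val h₂)
    have hm := S.bd_mem false h x.1 x.2
    rw [ha, bd_idt] at hm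
    exact ⟨⟨a, hm⟩, Subtype.ext ha⟩
  prod hC hD := by
    intro j k h hk x y hxy hyx h₁ h₂
    obtain ⟨a, ha⟩ := hC h hk x.1 y.1 (congrArg Prod.fst hxy) (congrArg Prod.fst hyx)
      (congrArg Prod.fst h₁) (congrArg Prod.fst h₂)
    obtain ⟨b, hb⟩ := hD h hk x.2 y.2 (congrArg Prod.snd hxy) (congrArg Prod.snd hyx)
      (congrArg Prod.snd h₁) (congrArg Prod.snd h₂)
    exact ⟨(a, b), Prod.ext ha hb⟩
  op δ _ hC := hC.op δ

end Classes

/-! ### Formal consequences for the category of autoequivalences -/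

section Autoequivalences

variable {D : Type v} [Category.{w} D] (Φ : Discrete (Signs n) ⥤ AutCat D)

/-- A functor from signs to autoequivalences is an equivalence if its values represent all
autoequivalences and have no natural transformations other than identities. -/
lemma isEquivalence_of_signs
    (h₁ : ∀ ⦃δ δ' : Signs n⦄, ((Φ.obj ⟨δ⟩).obj ⟶ (Φ.obj ⟨δ'⟩).obj) → δ = δ')
    (h₂ : ∀ ⦃δ δ' : Signs n⦄ (α α' : (Φ.obj ⟨δ⟩).obj ⟶ (Φ.obj ⟨δ'⟩).obj), α = α')
    (h₃ : ∀ E : D ≌ D, ∃ δ : Signs n, Nonempty ((Φ.obj ⟨δ⟩).obj ≅ E.functor)) :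
    Φ.IsEquivalence where
  faithful := ⟨fun _ => Subsingleton.elim _ _⟩
  full := ⟨fun α => ⟨Discrete.eqToHom (h₁ α.hom), ObjectProperty.hom_ext _ (h₂ _ _)⟩⟩
  essSurj := ⟨fun A => by
    have : A.obj.IsEquivalence := A.property
    obtain ⟨δ, ⟨i⟩⟩ := h₃ A.obj.asEquivalence
    exact ⟨⟨δ⟩, ⟨ObjectProperty.isoMk _ i⟩⟩⟩

/-- An equivalence from signs to autoequivalences is monoidal if it respects units and products
up to isomorphism: the coherence conditions are automatic. -/
lemma nonempty_monoidal_of_signs [Φ.IsEquivalence] (h₀ : Nonempty (𝟭 D ≅ (Φ.obj ⟨0⟩).obj))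
    (h : ∀ δ δ' : Signs n, Nonempty ((Φ.obj ⟨δ⟩).obj ⋙ (Φ.obj ⟨δ'⟩).obj ≅
      (Φ.obj ⟨δ + δ'⟩).obj)) : Nonempty Φ.Monoidal := by
  -- `AutCat D` is equivalent to a discrete category, so any two parallel morphisms agree, and every
  -- coherence diagram commutes.
  have thin {A B : AutCat D} (f g : A ⟶ B) : f = g :=
    Φ.inv.map_injective (Subsingleton.elim _ _)
  exact ⟨Functor.CoreMonoidal.toMonoidal
    { εIso := ObjectProperty.isoMk _ h₀.some
      μIso := fun X Y => ObjectProperty.isoMk _ (h X.as Y.as).some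
      μIso_hom_natural_left := fun _ _ => thin _ _
      μIso_hom_natural_right := fun _ _ => thin _ _
      associativity := fun _ _ _ => thin _ _
      left_unitality := fun _ => thin _ _
      right_unitality := fun _ => thin _ _ }⟩

end Autoequivalences

/-! ### Units and products of the functors `op_δ` -/

section Products

lemma reverses_zero (j : Dim n) : ¬ Reverses (0 : Signs n) j := fun ⟨_, h⟩ => zero_ne_one h

lemma reverses_add (δ δ' : Signs n) (j : Dim n) :
    Reverses (δ + δ') j ↔ ¬ (Reverses δ j ↔ Reverses δ' j) := by
  by_cases h : 1 ≤ j.1 + 1 ∧ ((j.1 + 1 : ℕ) : ℕ∞) ≤ n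
  · rw [reverses_iff h, reverses_iff h, reverses_iff h, Pi.add_apply]
    generalize δ _ = a
    generalize δ' _ = b
    revert a b
    decide
  · have h' (δ : Signs n) : ¬ Reverses δ j := fun ⟨h₁, _⟩ => h h₁
    simp [h']

/-- `op_δ` for `δ = 0` is the identity. -/
noncomputable def opZeroIso (C : StrictNCat.{u} n) : C ≅ C.op 0 where
  hom :=
    { app := fun _ x => x
      map_src := fun {j k} h x => by simp [op, reverses_zero]
      map_tgt := fun {j k} h x => by simp [op, reverses_zero]
      map_idt := fun h x => rfl
      map_comp := fun {j k} h x y hxy hxy' => by simp [op, reverses_zero] }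
  inv :=
    { app := fun _ x => x
      map_src := fun {j k} h x => by simp [op, reverses_zero]
      map_tgt := fun {j k} h x => by simp [op, reverses_zero]
      map_idt := fun h x => rfl
      map_comp := fun {j k} h x y hxy hxy' => by simp [op, reverses_zero] }
  hom_inv_id := rfl
  inv_hom_id := rfl

/-- `op_δ` followed by `op_δ'` is `op_(δ + δ')`. -/
noncomputable def opAddIso (δ δ' : Signs n) (C : StrictNCat.{u} n) :
    (C.op δ).op δ' ≅ C.op (δ + δ') where
  hom :=
    { app := fun _ x => x
      map_src := fun {j k} h x => by
        by_cases hj : Reverses δ j <;> by_cases hj' : Reverses δ' j <;>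
          simp [op, hj, hj', reverses_add]
      map_tgt := fun {j k} h x => by
        by_cases hj : Reverses δ j <;> by_cases hj' : Reverses δ' j <;>
          simp [op, hj, hj', reverses_add]
      map_idt := fun h x => rfl
      map_comp := fun {j k} h x y hxy hxy' => by
        by_cases hj : Reverses δ j <;> by_cases hj' : Reverses δ' j <;>
          simp [op, hj, hj', reverses_add] }
  inv :=
    { app := fun _ x => x
      map_src := fun {j k} h x => by
        by_cases hj : Reverses δ j <;> by_cases hj' : Reverses δ' j <;>
          simp [op, hj, hj', reverses_add]
      map_tgt := fun {j k} h x => by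
        by_cases hj : Reverses δ j <;> by_cases hj' : Reverses δ' j <;>
          simp [op, hj, hj', reverses_add]
      map_idt := fun h x => rfl
      map_comp := fun {j k} h x y hxy hxy' => by
        by_cases hj : Reverses δ j <;> by_cases hj' : Reverses δ' j <;>
          simp [op, hj, hj', reverses_add] }
  hom_inv_id := rfl
  inv_hom_id := rfl

end Products

/-! ### Conclusion for all and for rigid strict `n`-categories -/

/-- A natural transformation between the functors `op_δ` on all strict `n`-categories, regarded
on the class of all strict `n`-categories. -/
noncomputable def natTransTop {δ δ' : Signs n} (α : opFunctor.{u} δ ⟶ opFunctor δ') :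
    classOp (⊤ : ObjectProperty (StrictNCat.{u} n)) δ ⟶ classOp ⊤ δ' where
  app C := ObjectProperty.homMk (α.app C.obj)
  naturality _ _ f := ObjectProperty.hom_ext _ (α.naturality f.hom)

lemma exists_iso_opFunctor (E : StrictNCat.{u} n ≌ StrictNCat.{u} n) :
    ∃ δ : Signs n, Nonempty (opFunctor δ ≅ E.functor) := by
  -- Conjugation by `T` moves `E` to the full subcategory on the class of all strict `n`-categories,
  -- where the result for admissible classes applies.
  let T := ObjectProperty.topEquivalence (StrictNCat.{u} n)
  obtain ⟨δ, ⟨i⟩⟩ := exists_iso_classOp ((T.trans E).trans T.symm)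
  let j : ∀ C, (opFunctor δ).obj C ≅ E.functor.obj C := fun C =>
    (ObjectProperty.ι _).mapIso (i.app ⟨C, trivial⟩)
  refine ⟨δ, ⟨NatIso.ofComponents j fun {C D} f => ?_⟩⟩
  exact congrArg InducedCategory.Hom.hom
    (i.hom.naturality (X := ⟨C, trivial⟩) (Y := ⟨D, trivial⟩) (ObjectProperty.homMk f))

instance isEquivalence_opAut : (opAut.{u} n).IsEquivalence :=
  isEquivalence_of_signs _ (fun _ _ α => eq_of_natTrans (natTransTop α))
    (fun _ _ α α' => NatTrans.ext (funext fun C => congrArg InducedCategory.Hom.hom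
      (congrArg (fun β => NatTrans.app β ⟨C, trivial⟩)
        (natTrans_unique (natTransTop α) (natTransTop α')))))
    exists_iso_opFunctor

instance isEquivalence_rigidOpAut : (rigidOpAut.{u} n).IsEquivalence :=
  isEquivalence_of_signs _ (fun _ _ α => eq_of_natTrans (P := IsRigid n) α)
    (fun _ _ α α' => natTrans_unique (P := IsRigid n) α α')
    (exists_iso_classOp (P := IsRigid n))

lemma nonempty_monoidal_opAut : Nonempty (opAut.{u} n).Monoidal :=
  nonempty_monoidal_of_signs _ ⟨NatIso.ofComponents opZeroIso fun _ => rfl⟩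
    fun δ δ' => ⟨NatIso.ofComponents (opAddIso δ δ') fun _ => rfl⟩

lemma nonempty_monoidal_rigidOpAut : Nonempty (rigidOpAut.{u} n).Monoidal :=
  nonempty_monoidal_of_signs _
    ⟨NatIso.ofComponents (fun C => (IsRigid n).isoMk (opZeroIso C.obj)) fun _ => rfl⟩
    fun δ δ' =>
      ⟨NatIso.ofComponents (fun C => (IsRigid n).isoMk (opAddIso δ δ' C.obj)) fun _ => rfl⟩

end StrictNCat

open StrictNCat in
theorem mainTheorem8 (n : ℕ∞) :
    ((opAut.{u} n).IsEquivalence ∧ Nonempty (opAut.{u} n).Monoidal) ∧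
      ((rigidOpAut.{u} n).IsEquivalence ∧ Nonempty (rigidOpAut.{u} n).Monoidal) :=
  ⟨⟨isEquivalence_opAut, nonempty_monoidal_opAut⟩,
    ⟨isEquivalence_rigidOpAut, nonempty_monoidal_rigidOpAut⟩⟩
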